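/- Let $\tau\in(0,1)$, let $q_0,q_1,q_2,q_3\ge 0$ and $M$ be real numbers, and put $\mathbf q:=\max\{3q_1,\,q_1+q_2,\,q_3\}$, $\bar{\mathbf q}_0:=2\lceil q_0\mathbf q/2\rceil$ and $q^*:=2^{(\bar{\mathbf q}_0+4)/2}$. There is a constant $C_0=C_0(\tau,q_0,\dots,q_3,M)>0$ such that the following holds for all positive integers $n,p,d$ with $\tau\le p/n\le 1/\tau$. *Losses.* Let $\ell_1,\dots,\ell_n:\mathbb R\to\mathbb R$, $\bar\rho\in(0,1]$, $L_{\ell_1},\dots,L_{\ell_n}\ge 1$ and $\mathcal M_\ell,D_\ell:(0,\bar\rho)\to[0,\infty)$ with $\mathcal M_\ell\le 1\le D_\ell$ be such that (i) $\sup_x |\ell_i(x)|/(1+|x|^{q_0})\le L_{\ell_i}$ for all $i$; (ii) for every $\rho\in(0,\bar\rho)$ and every $i$ there is given a function $\ell_{i;\rho}\in C^3(\mathbb R)$ with values in $[0,\infty)$ such that $\|\ell_{i;\rho}-\ell_i\|_\infty\le \mathcal M_\ell(\rho)$ and $\sup_x |\ell_{i;\rho}^{(k)}(x)|/(1+|\ell_{i;\rho}(x)|^{q_k})\le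 D_\ell(\rho)$ for $k=1,2,3$. Let $R:\mathbb R^p\to\mathbb R$ be any function. *Designs.* Let $\Sigma\in\mathbb R^{p\times p}$ be positive definite with $\lambda_{\max}(\Sigma)\le M$. Let $X_1,\dots,X_n$ be i.i.d. random vectors in $\mathbb R^p$, and let $W_1,\dots,W_n$ be i.i.d. random vectors in $\mathbb R^p$, with $E[X_i]=E[W_i]=0$, $E[X_iX_i^\top]=E[W_iW_i^\top]=\Sigma/n$, and $(E|\sqrt n X_{i,j}|^{q^*})^{1/q^*}\le M$, $(E|\sqrt n W_{i,j}|^{q^*})^{1/q^*}\le M$ for all $i\in\{1,\dots,n\}$, $j\in\{1,\dots,p\}$. Suppose that $X_i$ and $W_i$ are $d$-block dependent; here a random vector $Z$ in $\mathbb R^p$ is $d$-block dependent if $\{1,\dots,p\}$ is the union of $k\le p$ pairwise disjoint cells $B_1,\dots,B_k$ with $\max_j|B_j|\le d$ such that the subvectors $(Z_l)_{l\in B_1},\dots,(Z_l)_{l\in B_k}$ are mutually independent. (The partitions for $X_i$ and for $W_i$ may differ.) *Conclusion.* For $w\in\mathbb R^p$ and $\mathbf Z=(Z_1,\dots,Z_n)^\top\in\mathbb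 R^{n\times p}$ put $\bar H_{\ell_\rho}(w,\mathbf Z):=\sum_{i=1}^n \ell_{i;\rho}(Z_i^\top w)+nR(w)$, and for a finite set $\mathcal W$ and $\beta>0$ put $F_\beta\big((x_w)_{w\in\mathcal W}\big):=-\beta^{-1}\log\sum_{w\in\mathcal W}e^{-\beta x_w}$. Then, with $\mathbf X=(X_1,\dots,X_n)^\top$ and $\mathbf W=(W_1,\dots,W_n)^\top$, for every $L_n\ge 1$, every finite set $\mathcal W\subset[-L_n,L_n]^p$, every $\rho\in(0,\bar\rho)$, every $\beta>0$ and every $g\in C^3(\mathbb R)$ with $K_g:=1+\max_{0\le k\le 3}\|g^{(k)}\|_\infty<\infty$, $$ \Big|E\big[g\big(n^{-1}F_\beta((\bar H_{\ell_\rho}(w,\mathbf X))_{w\in\mathcal W})\big)\big]-E\big[g\big(n^{-1}F_\beta((\bar H_{\ell_\rho}(w,\mathbf W))_{w\in\mathcal W})\big)\big]\Big| \le C_0\,K_g\,\max\{1,\beta^2\}\,L_n^{\bar{\mathbf q}_0+3}\,D_\ell(\rho)^3\,\Big(\frac1n\sum_{i=1}^n L_{\ell_i}^{\mathbf q}\Big)\,\sigma_n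 , $$ where $$ \sigma_n:=\frac{p\,d^{\,3+\bar{\mathbf q}_0/2}}{n^{5/2}}+\frac{p\,d^{2}}{n^{3/2}}+\frac{p\,d^{\,\bar{\mathbf q}_0+2}}{n^{(\bar{\mathbf q}_0+3)/2}} . $$ -/

import Mathlib

open MeasureTheory ProbabilityTheory
open scoped ENNReal Matrix

noncomputable section

namespace BlockUniversality

/-- The exponent `max {3 q₁, q₁ + q₂, q₃}`. -/
def qMax (q : Fin 4 → ℝ) : ℝ := max (3 * q 1) (max (q 1 + q 2) (q 3))

/-- The even natural number `2 ⌈q₀ qMax / 2⌉`. -/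
def qBar (q : Fin 4 → ℝ) : ℕ := 2 * ⌈q 0 * qMax q / 2⌉₊

/-- The order `2 ^ ((qBar + 4) / 2)` of the moments of the rescaled covariates. -/
def qStar (q : Fin 4 → ℝ) : ℝ := (2 : ℝ) ^ (((qBar q : ℝ) + 4) / 2)

/-- Proportional regime: `τ ≤ p / n ≤ 1 / τ`. -/
def ProportionalRegime (τ : ℝ) (n p : ℕ) : Prop :=
  0 < n ∧ τ ≤ (p : ℝ) / n ∧ (p : ℝ) / n ≤ 1 / τ

/-- The assumption on the loss functions `ℓ i`, their smooth approximations `ℓs i ρ` for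
`ρ ∈ (0, ρbar)`, the growth constants `Lc i`, the derivative bound `D` and the approximation
error `A`. -/
structure LossAssumption (q : Fin 4 → ℝ) {n : ℕ} (ℓ : Fin n → ℝ → ℝ)
    (ℓs : Fin n → ℝ → ℝ → ℝ) (ρbar : ℝ) (Lc : Fin n → ℝ) (D A : ℝ → ℝ) : Prop where
  q_nonneg : ∀ k, 0 ≤ q k
  ρbar_mem : ρbar ∈ Set.Ioc (0 : ℝ) 1
  one_le_Lc : ∀ i, 1 ≤ Lc i
  A_nonneg : ∀ ρ ∈ Set.Ioo 0 ρbar, 0 ≤ A ρ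
  A_le_one : ∀ ρ ∈ Set.Ioo 0 ρbar, A ρ ≤ 1
  one_le_D : ∀ ρ ∈ Set.Ioo 0 ρbar, 1 ≤ D ρ
  growth : ∀ i x, |ℓ i x| / (1 + |x| ^ q 0) ≤ Lc i
  smooth_nonneg : ∀ i, ∀ ρ ∈ Set.Ioo 0 ρbar, ∀ x, 0 ≤ ℓs i ρ x
  smooth_contDiff : ∀ i, ∀ ρ ∈ Set.Ioo 0 ρbar, ContDiff ℝ 3 (ℓs i ρ)
  approx : ∀ i, ∀ ρ ∈ Set.Ioo 0 ρbar, ∀ x, |ℓs i ρ x - ℓ i x| ≤ A ρ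
  self_bounding : ∀ k : Fin 4, k ≠ 0 → ∀ i, ∀ ρ ∈ Set.Ioo 0 ρbar, ∀ x,
    |iteratedDeriv (k : ℕ) (ℓs i ρ) x| / (1 + |ℓs i ρ x| ^ q k) ≤ D ρ

/-- A random vector `Z` in `ℝ^p` is `d`-block dependent: the coordinates can be partitioned into
`k ≤ p` cells of size at most `d` such that the corresponding subvectors are (mutually)
independent. -/
def IsBlockDependent {Ω : Type*} [MeasurableSpace Ω] (P : Measure Ω) {p : ℕ} (d : ℕ)
    (Z : Ω → Fin p → ℝ) : Prop :=
  ∃ (k : ℕ) (B : Fin k → Finset (Fin p)),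
    k ≤ p ∧
    (∀ i j, i ≠ j → Disjoint (B i) (B j)) ∧
    (∀ l : Fin p, ∃ j, l ∈ B j) ∧
    (∀ j, (B j).card ≤ d) ∧
    iIndepFun (fun (j : Fin k) (ω : Ω) (l : B j) => Z ω l) P

/-- The rows `Z 0, …, Z (n - 1)` are i.i.d. centred `d`-block dependent random vectors in `ℝ^p`
with covariance matrix `S / n`, and the coordinates of the rescaled rows `√n Z i` have `L^r`-norm
at most `M`. -/
structure IsDesign {Ω : Type*} [MeasurableSpace Ω] (P : Measure Ω) {n p : ℕ} (d : ℕ)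
    (S : Matrix (Fin p) (Fin p) ℝ) (r M : ℝ) (Z : Fin n → Ω → Fin p → ℝ) : Prop where
  measurable : ∀ i, Measurable (Z i)
  indep : iIndepFun Z P
  identDistrib : ∀ i j, IdentDistrib (Z i) (Z j) P P
  blockDependent : ∀ i, IsBlockDependent P d (Z i)
  mean : ∀ i j, ∫ ω, Z i ω j ∂P = 0
  secondMoment : ∀ i j k, ∫ ω, Z i ω j * Z i ω k ∂P = S j k / n
  moment : ∀ i j,
    eLpNorm (fun ω => Real.sqrt n * Z i ω j) (ENNReal.ofReal r) P ≤ ENNReal.ofReal M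

/-- The empirical risk `n⁻¹ ∑ᵢ ℓᵢ(Xᵢᵀ w) + R(w)`, where `X i` is the `i`-th row of the design
matrix. -/
def risk {n p : ℕ} (ℓ : Fin n → ℝ → ℝ) (R : (Fin p → ℝ) → ℝ) (w : Fin p → ℝ)
    (X : Fin n → Fin p → ℝ) : ℝ :=
  (1 / (n : ℝ)) * ∑ i, ℓ i (X i ⬝ᵥ w) + R w

/-- The soft minimum `-β⁻¹ log ∑_{w ∈ s} exp (-β x_w)`. -/
def softMin {ι : Type*} (β : ℝ) (s : Finset ι) (x : ι → ℝ) : ℝ :=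
  -(1 / β) * Real.log (∑ w ∈ s, Real.exp (-β * x w))

/-- `n⁻¹ F_β((n H(w, X))_{w ∈ s})`, with `H` the empirical risk. -/
def normalizedSoftMin {n p : ℕ} (β : ℝ) (s : Finset (Fin p → ℝ)) (ℓ : Fin n → ℝ → ℝ)
    (R : (Fin p → ℝ) → ℝ) (X : Fin n → Fin p → ℝ) : ℝ :=
  (1 / (n : ℝ)) * softMin β s (fun w => n * risk ℓ R w X)

/-- `g` and its derivatives up to order three are bounded. -/
def BoundedDerivs (g : ℝ → ℝ) : Prop :=
  ∀ k : Fin 4, BddAbove (Set.range fun x => |iteratedDeriv (k : ℕ) g x|)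

/-- `K_g = 1 + max_{k ≤ 3} ‖g^(k)‖_∞`, meaningful when `BoundedDerivs g` holds. -/
def Kg (g : ℝ → ℝ) : ℝ := 1 + ⨆ k : Fin 4, ⨆ x : ℝ, |iteratedDeriv (k : ℕ) g x|

/-- The average `n⁻¹ ∑ᵢ Lᵢ ^ a`. -/
def Av {n : ℕ} (Lc : Fin n → ℝ) (a : ℝ) : ℝ := (1 / (n : ℝ)) * ∑ i, Lc i ^ a

/-- The rate `p d^(3+b/2) / n^(5/2) + p d^2 / n^(3/2) + p d^(b+2) / n^((b+3)/2)`. -/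
def sigmaRate (b n p d : ℕ) : ℝ :=
  (p : ℝ) * (d : ℝ) ^ (3 + (b : ℝ) / 2) / (n : ℝ) ^ ((5 : ℝ) / 2)
    + (p : ℝ) * (d : ℝ) ^ 2 / (n : ℝ) ^ ((3 : ℝ) / 2)
    + (p : ℝ) * (d : ℝ) ^ (b + 2) / (n : ℝ) ^ (((b : ℝ) + 3) / 2)

end BlockUniversality

end


/-!
Lindeberg's replacement is applied twice: row by row and, inside a row, block by block. Two laws of
a row with different partitions are both compared with the law whose subvectors on the
intersections of the cells come from independent copies of the row: it has the same covariance
matrix, because covariances between distinct cells of either partition vanish, and it is block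
dependent for both partitions.

The third derivative of the test function composed with the soft minimum is a combination of Gibbs
means of products of derivatives of the losses. By self-boundedness these are powers of the size
`max 1 ℓ`, and since Gibbs means of monotonically related functions are positively correlated,
everything is bounded by the Gibbs mean of a single power of the size of the loss of that row. This
loss also enters the energy, where it favours the points at which it is small; removing it only
increases the mean and leaves Gibbs weights independent of the row. What has to be
bounded is then an even moment of a sum of independent centred blocks, for which an induction on the
order gives a bound of Rosenthal type.
-/

noncomputable section

namespace BlockUniversality

section Taylor

theorem abs_taylor_two_sub_le {φ : ℝ → ℝ} (hφ : ContDiff ℝ 3 φ) {K : ℝ}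
    (hK : ∀ t ∈ Set.Icc (0 : ℝ) 1, |iteratedDeriv 3 φ t| ≤ K) :
    |φ 1 - (φ 0 + deriv φ 0 + iteratedDeriv 2 φ 0 / 2)| ≤ K := by
  have hu : UniqueDiffOn ℝ (Set.Icc (0 : ℝ) 1) := uniqueDiffOn_Icc zero_lt_one
  have hI : ∀ k ≤ 3, ∀ t ∈ Set.Icc (0 : ℝ) 1,
      iteratedDerivWithin k φ (Set.Icc 0 1) t = iteratedDeriv k φ t := fun k hk t ht =>
    iteratedDerivWithin_eq_iteratedDeriv hu (hφ.contDiffAt.of_le (by exact_mod_cast hk)) ht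
  have h0 : (0 : ℝ) ∈ Set.Icc (0 : ℝ) 1 := ⟨le_rfl, zero_le_one⟩
  have h := taylor_mean_remainder_bound (n := 2) zero_le_one hφ.contDiffOn
    ⟨zero_le_one, le_rfl⟩ fun t ht => by rw [Real.norm_eq_abs, hI 3 le_rfl t ht]; exact hK t ht
  simp only [taylor_within_apply, Finset.sum_range_succ, Finset.range_zero, Finset.sum_empty,
    hI 0 (by norm_num) 0 h0, hI 1 (by norm_num) 0 h0, hI 2 (by norm_num) 0 h0, Real.norm_eq_abs,
    iteratedDeriv_zero, iteratedDeriv_one] at h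
  norm_num at h
  have hK0 : 0 ≤ K := (abs_nonneg _).trans (hK 0 h0)
  rw [div_eq_inv_mul]
  linarith

end Taylor

section GibbsMean

variable {ι : Type*} {β : ℝ} {s : Finset ι} {x f h F : ι → ℝ}

/-- The mean of `f` under the Gibbs measure on `s` with energies `x` at inverse temperature `β`;
it is `0` when `s` is empty. -/
def gibbsMean (β : ℝ) (s : Finset ι) (x f : ι → ℝ) : ℝ :=
  s.centerMass (fun i => Real.exp (-β * x i)) f

/-- The covariance of `f` and `h` under the Gibbs measure. -/
def gibbsCov (β : ℝ) (s : Finset ι) (x f h : ι → ℝ) : ℝ :=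
  gibbsMean β s x (fun i => f i * h i) - gibbsMean β s x f * gibbsMean β s x h

theorem gibbsMean_eq_div : gibbsMean β s x f =
    (∑ i ∈ s, Real.exp (-β * x i) * f i) / ∑ i ∈ s, Real.exp (-β * x i) := by
  simp only [gibbsMean, Finset.centerMass, smul_eq_mul, div_eq_inv_mul]

theorem sum_exp_pos (hs : s.Nonempty) (β : ℝ) (x : ι → ℝ) : 0 < ∑ i ∈ s, Real.exp (-β * x i) :=
  Finset.sum_pos (fun _ _ => Real.exp_pos _) hs

theorem gibbsMean_mono (hf : ∀ i ∈ s, f i ≤ h i) : gibbsMean β s x f ≤ gibbsMean β s x h := by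
  rw [gibbsMean_eq_div, gibbsMean_eq_div]
  gcongr with i hi
  exact hf i hi

theorem gibbsMean_add : gibbsMean β s x (fun i => f i + h i) =
    gibbsMean β s x f + gibbsMean β s x h := by
  simp only [gibbsMean_eq_div, mul_add, Finset.sum_add_distrib, add_div]

theorem gibbsMean_const_mul (c : ℝ) :
    gibbsMean β s x (fun i => c * f i) = c * gibbsMean β s x f := by
  simp only [gibbsMean_eq_div, mul_left_comm _ c, ← Finset.mul_sum, mul_div_assoc]

theorem gibbsMean_const (hs : s.Nonempty) (c : ℝ) : gibbsMean β s x (fun _ => c) = c := by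
  rw [gibbsMean_eq_div, ← Finset.sum_mul, mul_div_cancel_left₀ _ (sum_exp_pos hs β x).ne']

theorem gibbsMean_nonneg (hf : ∀ i ∈ s, 0 ≤ f i) : 0 ≤ gibbsMean β s x f := by
  rw [gibbsMean_eq_div]
  exact div_nonneg (Finset.sum_nonneg fun i hi => mul_nonneg (Real.exp_pos _).le (hf i hi))
    (Finset.sum_nonneg fun _ _ => (Real.exp_pos _).le)

theorem abs_gibbsMean_le (hf : ∀ i ∈ s, |f i| ≤ F i) : |gibbsMean β s x f| ≤ gibbsMean β s x F := by
  refine abs_le.2 ⟨?_, gibbsMean_mono fun i hi => (le_abs_self _).trans (hf i hi)⟩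
  rw [← neg_one_mul, ← gibbsMean_const_mul]
  exact gibbsMean_mono fun i hi => by linarith [neg_abs_le (f i), hf i hi]

theorem gibbsMean_mul_le_of_monovaryOn (hs : s.Nonempty) (hfh : MonovaryOn f h s) :
    gibbsMean β s x f * gibbsMean β s x h ≤ gibbsMean β s x (fun i => f i * h i) := by
  set e := fun i => Real.exp (-β * x i)
  have he : ∀ i, 0 < e i := fun i => Real.exp_pos _
  -- Symmetrize: the difference is half the double sum of `eᵢ eⱼ (fᵢ - fⱼ) (hᵢ - hⱼ) ≥ 0`.
  have hsym : 0 ≤ ∑ i ∈ s, ∑ j ∈ s, e i * e j * ((f i - f j) * (h i - h j)) :=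
    Finset.sum_nonneg fun i hi => Finset.sum_nonneg fun j hj =>
      mul_nonneg (mul_pos (he i) (he j)).le (hfh.sub_mul_sub_nonneg hj hi)
  have hexp : ∑ i ∈ s, ∑ j ∈ s, e i * e j * ((f i - f j) * (h i - h j)) =
      2 * ((∑ i ∈ s, e i * (f i * h i)) * ∑ i ∈ s, e i
        - (∑ i ∈ s, e i * f i) * ∑ i ∈ s, e i * h i) := by
    have : ∀ i j, e i * e j * ((f i - f j) * (h i - h j)) = e i * (f i * h i) * e j
        + e i * (e j * (f j * h j)) - (e i * f i) * (e j * h j) - (e i * h i) * (e j * f j) := by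
      intro i j; ring
    simp only [this, Finset.sum_add_distrib, Finset.sum_sub_distrib, ← Finset.mul_sum,
      ← Finset.sum_mul]
    ring
  simp only [gibbsMean_eq_div]
  rw [div_mul_div_comm, div_le_div_iff₀ (mul_pos (sum_exp_pos hs β x) (sum_exp_pos hs β x))
    (sum_exp_pos hs β x), ← mul_assoc]
  exact mul_le_mul_of_nonneg_right (by linarith) (sum_exp_pos hs β x).le

theorem gibbsMean_add_energy_mul (hs : s.Nonempty) (a : ι → ℝ) :
    gibbsMean β s (fun i => x i + a i) F * gibbsMean β s x (fun i => Real.exp (-β * a i)) =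
      gibbsMean β s x (fun i => F i * Real.exp (-β * a i)) := by
  have h₁ := (sum_exp_pos hs β fun i => x i + a i).ne'
  simp only [gibbsMean_eq_div, mul_add, Real.exp_add] at h₁ ⊢
  rw [div_mul_div_cancel₀ h₁]
  exact congrArg (· / _) (Finset.sum_congr rfl fun i _ => by ring)

theorem gibbsMean_add_energy_le_of_monovaryOn (hs : s.Nonempty) (hβ : 0 ≤ β) {a : ι → ℝ}
    (hFa : MonovaryOn F a s) : gibbsMean β s (fun i => x i + a i) F ≤ gibbsMean β s x F := by
  set e := fun i => Real.exp (-β * a i) with he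
  have hanti : AntivaryOn F e s := fun i hi j hj hij =>
    hFa hj hi (lt_of_not_ge fun hji => hij.not_ge (Real.exp_le_exp.2 (by nlinarith)))
  have h := gibbsMean_mul_le_of_monovaryOn (β := β) (x := x) hs
    (show MonovaryOn (fun i => -1 * F i) e s from fun i hi j hj hij => by
      linarith [hanti hi hj hij])
  simp only [mul_assoc, gibbsMean_const_mul] at h
  have hpos : 0 < gibbsMean β s x e := by
    rw [gibbsMean_eq_div]
    exact div_pos (Finset.sum_pos (fun i _ => mul_pos (Real.exp_pos _) (Real.exp_pos _)) hs)
      (sum_exp_pos hs β x)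
  refine le_of_mul_le_mul_right ?_ hpos
  rw [he, gibbsMean_add_energy_mul hs]
  linarith

theorem gibbsMean_rpow_mul_le (hs : s.Nonempty) {U : ι → ℝ} (hU : ∀ i ∈ s, 1 ≤ U i) {a b Q : ℝ}
    (ha : 0 ≤ a) (hb : 0 ≤ b) (hQ : a + b ≤ Q) :
    gibbsMean β s x (fun i => U i ^ a) * gibbsMean β s x (fun i => U i ^ b)
      ≤ gibbsMean β s x (fun i => U i ^ Q) := by
  refine (gibbsMean_mul_le_of_monovaryOn hs fun i hi j hj hij => ?_).trans
    (gibbsMean_mono fun i hi => ?_)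
  · have hlt : U i < U j := lt_of_not_ge fun hji =>
      hij.not_ge (Real.rpow_le_rpow (zero_le_one.trans (hU j hj)) hji hb)
    exact Real.rpow_le_rpow (zero_le_one.trans (hU i hi)) hlt.le ha
  · rw [← Real.rpow_add (zero_lt_one.trans_le (hU i hi))]
    exact Real.rpow_le_rpow_of_exponent_le (hU i hi) hQ

end GibbsMean

section SoftMin

variable {ι : Type*} {β : ℝ} {s : Finset ι} {a : ι → ℝ → ℝ} {t : ℝ}

theorem hasDerivAt_gibbsMean (hs : s.Nonempty) {a' f f' : ι → ℝ → ℝ}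
    (ha : ∀ i, HasDerivAt (a i) (a' i t) t) (hf : ∀ i, HasDerivAt (f i) (f' i t) t) :
    HasDerivAt (fun t => gibbsMean β s (a · t) (f · t))
      (gibbsMean β s (a · t) (f' · t) - β * gibbsCov β s (a · t) (f · t) (a' · t)) t := by
  have he : ∀ i, HasDerivAt (fun t => Real.exp (-β * a i t))
      (Real.exp (-β * a i t) * (-β * a' i t)) t := fun i => ((ha i).const_mul (-β)).exp
  have hz := (sum_exp_pos hs β (a · t)).ne'
  have h := (HasDerivAt.fun_sum (u := s) fun i _ => (he i).fun_mul (hf i)).div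
    (HasDerivAt.fun_sum (u := s) fun i _ => he i) hz
  simp only [gibbsCov, gibbsMean_eq_div]
  refine h.congr_deriv ?_
  have hnum : ∑ i ∈ s, (Real.exp (-β * a i t) * (-β * a' i t) * f i t +
      Real.exp (-β * a i t) * f' i t) = (∑ i ∈ s, Real.exp (-β * a i t) * f' i t)
      - β * ∑ i ∈ s, Real.exp (-β * a i t) * (f i t * a' i t) := by
    rw [Finset.mul_sum, ← Finset.sum_sub_distrib]
    exact Finset.sum_congr rfl fun i _ => by ring
  have hden : ∑ i ∈ s, Real.exp (-β * a i t) * (-β * a' i t) =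
      -β * ∑ i ∈ s, Real.exp (-β * a i t) * a' i t := by
    rw [Finset.mul_sum]
    exact Finset.sum_congr rfl fun i _ => by ring
  rw [hnum, hden]
  field_simp
  ring

theorem hasDerivAt_softMin (hs : s.Nonempty) (hβ : β ≠ 0) {a' : ι → ℝ → ℝ}
    (ha : ∀ i, HasDerivAt (a i) (a' i t) t) :
    HasDerivAt (fun t => softMin β s (a · t)) (gibbsMean β s (a · t) (a' · t)) t := by
  have he : ∀ i, HasDerivAt (fun t => Real.exp (-β * a i t))
      (Real.exp (-β * a i t) * (-β * a' i t)) t := fun i => ((ha i).const_mul (-β)).exp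
  have hz := (sum_exp_pos hs β (a · t)).ne'
  refine (((HasDerivAt.fun_sum (u := s) fun i _ => he i).log hz).const_mul
    (-(1 / β))).congr_deriv ?_
  simp only [mul_left_comm _ (-β), ← Finset.mul_sum, gibbsMean_eq_div]
  field_simp

theorem contDiff_softMin {E : Type*} [NormedAddCommGroup E] [NormedSpace ℝ E]
    (hs : s.Nonempty) {a : ι → E → ℝ} {n : WithTop ℕ∞} (ha : ∀ i, ContDiff ℝ n (a i)) :
    ContDiff ℝ n fun v => softMin β s (a · v) :=
  contDiff_const.mul ((ContDiff.sum fun i _ => (contDiff_const.mul (ha i)).exp).log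
    fun v => (sum_exp_pos hs β (a · v)).ne')

theorem hasDerivAt_iteratedDeriv {f : ℝ → ℝ} {n : ℕ} (hf : ContDiff ℝ n f) {k : ℕ} (hk : k < n)
    (t : ℝ) : HasDerivAt (iteratedDeriv k f) (iteratedDeriv (k + 1) f t) t := by
  rw [iteratedDeriv_succ]
  exact (hf.differentiable_iteratedDeriv k (by exact_mod_cast hk)).differentiableAt.hasDerivAt

/-- The third cumulant of `f` under the Gibbs measure. -/
def gibbsCumulant₃ (β : ℝ) (s : Finset ι) (x f : ι → ℝ) : ℝ :=
  gibbsMean β s x (fun i => f i ^ 3) - 3 * gibbsMean β s x (fun i => f i ^ 2) * gibbsMean β s x f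
    + 2 * gibbsMean β s x f ^ 3

theorem hasDerivAt_gibbsVariance (hs : s.Nonempty) {f f' : ι → ℝ → ℝ}
    (ha : ∀ i, HasDerivAt (a i) (f i t) t) (hf : ∀ i, HasDerivAt (f i) (f' i t) t) :
    HasDerivAt (fun t => gibbsCov β s (a · t) (f · t) (f · t))
      (2 * gibbsCov β s (a · t) (f' · t) (f · t) - β * gibbsCumulant₃ β s (a · t) (f · t)) t := by
  have hm := hasDerivAt_gibbsMean (β := β) hs ha hf
  refine ((hasDerivAt_gibbsMean (β := β) hs (f := fun i t => f i t * f i t)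
    (f' := fun i t => 2 * (f' i t * f i t)) ha fun i =>
      ((hf i).mul (hf i)).congr_deriv (by ring)).sub (hm.mul hm)).congr_deriv ?_
  simp only [gibbsCov, gibbsCumulant₃, gibbsMean_const_mul, pow_succ, pow_zero, one_mul]
  ring

theorem deriv_softMin (hs : s.Nonempty) (hβ : β ≠ 0) (ha : ∀ i, ContDiff ℝ 3 (a i)) :
    deriv (fun t => softMin β s (a · t)) =
      fun t => gibbsMean β s (a · t) (fun i => deriv (a i) t) :=
  deriv_eq fun _ => hasDerivAt_softMin hs hβ (a' := fun i => deriv (a i)) fun i =>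
    ((ha i).differentiable (by norm_num)).differentiableAt.hasDerivAt

theorem iteratedDeriv_two_softMin (hs : s.Nonempty) (hβ : β ≠ 0) (ha : ∀ i, ContDiff ℝ 3 (a i)) :
    iteratedDeriv 2 (fun t => softMin β s (a · t)) = fun t =>
      gibbsMean β s (a · t) (fun i => iteratedDeriv 2 (a i) t)
        - β * gibbsCov β s (a · t) (fun i => deriv (a i) t) (fun i => deriv (a i) t) := by
  rw [iteratedDeriv_succ, iteratedDeriv_one, deriv_softMin hs hβ ha]
  refine deriv_eq fun t => hasDerivAt_gibbsMean hs (a' := fun i => deriv (a i)) (fun i => ?_)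
    fun i => ?_
  · simpa using hasDerivAt_iteratedDeriv (ha i) (k := 0) (by norm_num) t
  · simpa using hasDerivAt_iteratedDeriv (ha i) (k := 1) (by norm_num) t

theorem iteratedDeriv_three_softMin (hs : s.Nonempty) (hβ : β ≠ 0)
    (ha : ∀ i, ContDiff ℝ 3 (a i)) : iteratedDeriv 3 (fun t => softMin β s (a · t)) = fun t =>
      gibbsMean β s (a · t) (fun i => iteratedDeriv 3 (a i) t)
        - 3 * β * gibbsCov β s (a · t) (fun i => iteratedDeriv 2 (a i) t) (fun i => deriv (a i) t)
        + β ^ 2 * gibbsCumulant₃ β s (a · t) (fun i => deriv (a i) t) := by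
  have h₁ : ∀ i t, HasDerivAt (a i) (deriv (a i) t) t := fun i t => by
    simpa using hasDerivAt_iteratedDeriv (ha i) (k := 0) (by norm_num) t
  have h₂ : ∀ i t, HasDerivAt (deriv (a i)) (iteratedDeriv 2 (a i) t) t := fun i t => by
    simpa using hasDerivAt_iteratedDeriv (ha i) (k := 1) (by norm_num) t
  have h₃ : ∀ i t, HasDerivAt (iteratedDeriv 2 (a i)) (iteratedDeriv 3 (a i) t) t := fun i t =>
    hasDerivAt_iteratedDeriv (ha i) (k := 2) (by norm_num) t
  rw [iteratedDeriv_succ, iteratedDeriv_two_softMin hs hβ ha]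
  refine deriv_eq fun t => ((hasDerivAt_gibbsMean (β := β) hs (h₁ · t) (h₃ · t)).sub
    ((hasDerivAt_gibbsVariance hs (h₁ · t) (h₂ · t)).const_mul β)).congr_deriv ?_
  ring

end SoftMin

section GibbsBounds

variable {ι : Type*} {β : ℝ} {s : Finset ι} {x f h U : ι → ℝ} {c c' r r' Q : ℝ}

theorem nonneg_of_abs_le_mul_rpow (hs : s.Nonempty) (hU : ∀ i ∈ s, 1 ≤ U i)
    (hf : ∀ i ∈ s, |f i| ≤ c * U i ^ r) : 0 ≤ c := by
  obtain ⟨i, hi⟩ := hs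
  exact nonneg_of_mul_nonneg_left ((abs_nonneg _).trans (hf i hi))
    (Real.rpow_pos_of_pos (zero_lt_one.trans_le (hU i hi)) _)

theorem abs_gibbsMean_le_mul (hs : s.Nonempty) (hU : ∀ i ∈ s, 1 ≤ U i) (hQ : r ≤ Q)
    (hf : ∀ i ∈ s, |f i| ≤ c * U i ^ r) :
    |gibbsMean β s x f| ≤ c * gibbsMean β s x (fun i => U i ^ Q) := by
  rw [← gibbsMean_const_mul]
  exact abs_gibbsMean_le fun i hi => (hf i hi).trans <| mul_le_mul_of_nonneg_left
    (Real.rpow_le_rpow_of_exponent_le (hU i hi) hQ) (nonneg_of_abs_le_mul_rpow hs hU hf)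

theorem abs_mul_le_mul_rpow (hU : ∀ i ∈ s, 1 ≤ U i) (hf : ∀ i ∈ s, |f i| ≤ c * U i ^ r)
    (hh : ∀ i ∈ s, |h i| ≤ c' * U i ^ r') : ∀ i ∈ s, |f i * h i| ≤ c * c' * U i ^ (r + r') := by
  intro i hi
  rw [abs_mul, Real.rpow_add (zero_lt_one.trans_le (hU i hi)), mul_mul_mul_comm]
  exact mul_le_mul (hf i hi) (hh i hi) (abs_nonneg _) ((abs_nonneg _).trans (hf i hi))

theorem abs_gibbsMean_mul_gibbsMean_le (hs : s.Nonempty) (hU : ∀ i ∈ s, 1 ≤ U i) (hr : 0 ≤ r)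
    (hr' : 0 ≤ r') (hQ : r + r' ≤ Q) (hf : ∀ i ∈ s, |f i| ≤ c * U i ^ r)
    (hh : ∀ i ∈ s, |h i| ≤ c' * U i ^ r') :
    |gibbsMean β s x f * gibbsMean β s x h| ≤ c * c' * gibbsMean β s x (fun i => U i ^ Q) := by
  have hc := nonneg_of_abs_le_mul_rpow hs hU hf
  have hc' := nonneg_of_abs_le_mul_rpow hs hU hh
  have hf' := abs_gibbsMean_le_mul (β := β) (x := x) hs hU le_rfl hf
  rw [abs_mul]
  calc |gibbsMean β s x f| * |gibbsMean β s x h|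
      ≤ c * gibbsMean β s x (fun i => U i ^ r) * (c' * gibbsMean β s x (fun i => U i ^ r')) :=
        mul_le_mul hf' (abs_gibbsMean_le_mul hs hU le_rfl hh) (abs_nonneg _)
          ((abs_nonneg _).trans hf')
    _ = c * c' * (gibbsMean β s x (fun i => U i ^ r) * gibbsMean β s x (fun i => U i ^ r')) := by
        ring
    _ ≤ _ := mul_le_mul_of_nonneg_left (gibbsMean_rpow_mul_le hs hU hr hr' hQ) (mul_nonneg hc hc')

theorem abs_gibbsCov_le (hs : s.Nonempty) (hU : ∀ i ∈ s, 1 ≤ U i) (hr : 0 ≤ r)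
    (hr' : 0 ≤ r') (hQ : r + r' ≤ Q) (hf : ∀ i ∈ s, |f i| ≤ c * U i ^ r)
    (hh : ∀ i ∈ s, |h i| ≤ c' * U i ^ r') :
    |gibbsCov β s x f h| ≤ 2 * (c * c' * gibbsMean β s x (fun i => U i ^ Q)) :=
  (abs_sub _ _).trans (by
    linarith [abs_gibbsMean_le_mul (β := β) (x := x) hs hU hQ (abs_mul_le_mul_rpow hU hf hh),
      abs_gibbsMean_mul_gibbsMean_le (β := β) (x := x) hs hU hr hr' hQ hf hh])

theorem abs_gibbsMean_sq_mul_le (hs : s.Nonempty) (hU : ∀ i ∈ s, 1 ≤ U i) (hr : 0 ≤ r)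
    (hQ : 3 * r ≤ Q) (hf : ∀ i ∈ s, |f i| ≤ c * U i ^ r) :
    |gibbsMean β s x (fun i => f i ^ 2) * gibbsMean β s x f| ≤
      c ^ 3 * gibbsMean β s x (fun i => U i ^ Q) := by
  simp only [sq]
  exact (abs_gibbsMean_mul_gibbsMean_le hs hU (add_nonneg hr hr) hr (by linarith)
    (abs_mul_le_mul_rpow hU hf hf) hf).trans_eq (by ring)

theorem abs_gibbsMean_pow_three_le (hs : s.Nonempty) (hU : ∀ i ∈ s, 1 ≤ U i) (hr : 0 ≤ r)
    (hQ : 3 * r ≤ Q) (hf : ∀ i ∈ s, |f i| ≤ c * U i ^ r) :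
    |gibbsMean β s x f| ^ 3 ≤ c ^ 3 * gibbsMean β s x (fun i => U i ^ Q) := by
  refine le_trans ?_ (abs_gibbsMean_sq_mul_le hs hU hr hQ hf)
  have h := gibbsMean_mul_le_of_monovaryOn (β := β) (x := x) hs (monovaryOn_self f s)
  rw [pow_succ, sq_abs, abs_mul]
  simp only [sq]
  exact mul_le_mul_of_nonneg_right (h.trans (le_abs_self _)) (abs_nonneg _)

theorem abs_gibbsCov_self_mul_gibbsMean_le (hs : s.Nonempty) (hU : ∀ i ∈ s, 1 ≤ U i)
    (hr : 0 ≤ r) (hQ : 3 * r ≤ Q) (hf : ∀ i ∈ s, |f i| ≤ c * U i ^ r) :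
    |gibbsCov β s x f f * gibbsMean β s x f| ≤
      2 * (c ^ 3 * gibbsMean β s x (fun i => U i ^ Q)) := by
  have h₂₁ := abs_gibbsMean_sq_mul_le (β := β) (x := x) hs hU hr hQ hf
  have h₁₁₁ := abs_gibbsMean_pow_three_le (β := β) (x := x) hs hU hr hQ hf
  have h : gibbsCov β s x f f * gibbsMean β s x f =
      gibbsMean β s x (fun i => f i ^ 2) * gibbsMean β s x f - gibbsMean β s x f ^ 3 := by
    simp only [gibbsCov, sq]
    ring
  rw [h]
  rw [← abs_pow] at h₁₁₁
  exact (abs_sub _ _).trans (by linarith)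

theorem abs_gibbsCumulant₃_le (hs : s.Nonempty) (hU : ∀ i ∈ s, 1 ≤ U i) (hr : 0 ≤ r)
    (hQ : 3 * r ≤ Q) (hf : ∀ i ∈ s, |f i| ≤ c * U i ^ r) :
    |gibbsCumulant₃ β s x f| ≤ 6 * (c ^ 3 * gibbsMean β s x (fun i => U i ^ Q)) := by
  have h₃ : |gibbsMean β s x (fun i => f i ^ 3)| ≤
      c ^ 3 * gibbsMean β s x (fun i => U i ^ Q) := by
    have h := abs_gibbsMean_le_mul (β := β) (x := x) (Q := Q) hs hU (by linarith)
      (abs_mul_le_mul_rpow hU (abs_mul_le_mul_rpow hU hf hf) hf)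
    simpa only [pow_succ, pow_zero, one_mul] using h
  have h₂₁ := abs_gibbsMean_sq_mul_le (β := β) (x := x) hs hU hr hQ hf
  have h₁₁₁ := abs_gibbsMean_pow_three_le (β := β) (x := x) hs hU hr hQ hf
  rw [← abs_pow] at h₁₁₁
  rw [gibbsCumulant₃, mul_assoc 3]
  refine (abs_add_le _ _).trans ((add_le_add_left (abs_sub _ _) _).trans ?_)
  rw [abs_mul 3, abs_mul 2, abs_of_pos (zero_lt_three' ℝ), abs_of_pos (zero_lt_two' ℝ)]
  linarith

end GibbsBounds

section ThirdDerivative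

variable {ι : Type*} {β t : ℝ} {s : Finset ι} {a : ι → ℝ → ℝ} {U : ι → ℝ}
  {c₁ c₂ c₃ r₁ r₂ r₃ Q : ℝ}

theorem abs_iteratedDeriv_two_softMin_mul_deriv_le (hs : s.Nonempty) (hβ : 0 < β)
    (ha : ∀ i, ContDiff ℝ 3 (a i)) (hU : ∀ i ∈ s, 1 ≤ U i) (hr₁ : 0 ≤ r₁) (hr₂ : 0 ≤ r₂)
    (hQ₁ : 3 * r₁ ≤ Q) (hQ₂ : r₁ + r₂ ≤ Q) (h₁ : ∀ i ∈ s, |deriv (a i) t| ≤ c₁ * U i ^ r₁)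
    (h₂ : ∀ i ∈ s, |iteratedDeriv 2 (a i) t| ≤ c₂ * U i ^ r₂) :
    |iteratedDeriv 2 (fun t => softMin β s (a · t)) t * deriv (fun t => softMin β s (a · t)) t| ≤
      (c₁ * c₂ + 2 * β * c₁ ^ 3) * gibbsMean β s (a · t) (fun i => U i ^ Q) := by
  have h₁₂ := abs_gibbsMean_mul_gibbsMean_le (β := β) (x := (a · t)) hs hU hr₁ hr₂ hQ₂ h₁ h₂
  have h₁₁₁ := mul_le_mul_of_nonneg_left
    (abs_gibbsCov_self_mul_gibbsMean_le (β := β) (x := (a · t)) hs hU hr₁ hQ₁ h₁) hβ.le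
  rw [deriv_softMin hs hβ.ne' ha, iteratedDeriv_two_softMin hs hβ.ne' ha, sub_mul, mul_assoc β]
  refine (abs_sub _ _).trans ?_
  rw [abs_mul β, abs_of_pos hβ, mul_comm (gibbsMean β s (a · t) _)]
  linarith

theorem abs_iteratedDeriv_three_softMin_le (hs : s.Nonempty) (hβ : 0 < β)
    (ha : ∀ i, ContDiff ℝ 3 (a i)) (hU : ∀ i ∈ s, 1 ≤ U i) (hr₁ : 0 ≤ r₁) (hr₂ : 0 ≤ r₂)
    (hQ₁ : 3 * r₁ ≤ Q) (hQ₂ : r₁ + r₂ ≤ Q) (hQ₃ : r₃ ≤ Q)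
    (h₁ : ∀ i ∈ s, |deriv (a i) t| ≤ c₁ * U i ^ r₁)
    (h₂ : ∀ i ∈ s, |iteratedDeriv 2 (a i) t| ≤ c₂ * U i ^ r₂)
    (h₃ : ∀ i ∈ s, |iteratedDeriv 3 (a i) t| ≤ c₃ * U i ^ r₃) :
    |iteratedDeriv 3 (fun t => softMin β s (a · t)) t| ≤
      (c₃ + 6 * β * (c₁ * c₂) + 6 * β ^ 2 * c₁ ^ 3) *
        gibbsMean β s (a · t) (fun i => U i ^ Q) := by
  have h₃' := abs_gibbsMean_le_mul (β := β) (x := (a · t)) hs hU hQ₃ h₃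
  have h₂₁ := mul_le_mul_of_nonneg_left (abs_gibbsCov_le (β := β) (x := (a · t)) (Q := Q) hs hU
    hr₂ hr₁ (by linarith) h₂ h₁) (by positivity : 0 ≤ 3 * β)
  have h₁₁₁ := mul_le_mul_of_nonneg_left
    (abs_gibbsCumulant₃_le (β := β) (x := (a · t)) hs hU hr₁ hQ₁ h₁) (sq_nonneg β)
  rw [iteratedDeriv_three_softMin hs hβ.ne' ha]
  refine (abs_add_le _ _).trans ((add_le_add_left (abs_sub _ _) _).trans ?_)
  rw [abs_mul (3 * β), abs_mul (β ^ 2), abs_of_pos (by positivity : 0 < 3 * β),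
    abs_of_nonneg (sq_nonneg β)]
  linarith

theorem abs_iteratedDeriv_three_comp_le {g G : ℝ → ℝ} {K N T : ℝ} (hg : ContDiff ℝ 3 g)
    (hG : ContDiff ℝ 3 G) (hK : ∀ k : Fin 4, ∀ x, |iteratedDeriv k g x| ≤ K) (hN : 1 ≤ N)
    (h₁ : |deriv G t| ^ 3 ≤ T) (h₂ : |iteratedDeriv 2 G t * deriv G t| ≤ 3 * T)
    (h₃ : |iteratedDeriv 3 G t| ≤ 13 * T) :
    |iteratedDeriv 3 (fun t => g (1 / N * G t)) t| ≤ 23 * K * T / N := by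
  have : 0 ≤ T := (by positivity : 0 ≤ |deriv G t| ^ 3).trans h₁
  have : 0 ≤ K := (abs_nonneg _).trans (hK 0 0)
  have hr : 0 < 1 / N := by positivity
  have hr₁ : 1 / N ≤ 1 := (div_le_one (by positivity)).2 hN
  have hr₂ : (1 / N) ^ 2 ≤ 1 / N := pow_le_of_le_one hr.le hr₁ two_ne_zero
  have hr₃ : (1 / N) ^ 3 ≤ 1 / N := pow_le_of_le_one hr.le hr₁ three_ne_zero
  have hcomp : iteratedDeriv 3 (fun t => g (1 / N * G t)) t =
      iteratedDeriv 3 g (1 / N * G t) * ((1 / N) ^ 3 * deriv G t ^ 3) +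
        3 * (iteratedDeriv 2 g (1 / N * G t) *
          ((1 / N) ^ 2 * (iteratedDeriv 2 G t * deriv G t))) +
        deriv g (1 / N * G t) * (1 / N * iteratedDeriv 3 G t) := by
    have h := iteratedDeriv_comp_three (x := t) (f := fun t => 1 / N * G t) hg.contDiffAt
      (contDiff_const.mul hG).contDiffAt
    simp only [iteratedDeriv_const_mul_field, deriv_const_mul_field] at h
    refine h.trans ?_
    ring
  have habs : ∀ {u v x y : ℝ}, |u| ≤ x → |v| ≤ y → |u * v| ≤ x * y := fun hu hv => by
    rw [abs_mul]
    exact mul_le_mul hu hv (abs_nonneg _) ((abs_nonneg _).trans hu)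
  have b₃ := habs (hK 3 (1 / N * G t)) (habs ((abs_of_pos (pow_pos hr 3)).le.trans hr₃)
    ((abs_pow _ _).trans_le h₁))
  have b₂ := habs (hK 2 (1 / N * G t)) (habs ((abs_of_pos (pow_pos hr 2)).le.trans hr₂) h₂)
  have b₁ := habs (hK 1 (1 / N * G t)) (habs (abs_of_pos hr).le h₃)
  simp only [Fin.val_one, iteratedDeriv_one] at b₁
  rw [hcomp]
  refine (abs_add_three _ _ _).trans ?_
  rw [abs_mul 3, abs_of_pos (three_pos (α := ℝ)), show 23 * K * T / N =
    K * (1 / N * T) + 3 * (K * (1 / N * (3 * T))) + K * (1 / N * (13 * T)) by ring]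
  exact add_le_add (add_le_add b₃ (mul_le_mul_of_nonneg_left b₂ three_pos.le)) b₁

theorem abs_iteratedDeriv_three_comp_softMin_le {q : Fin 4 → ℝ} {g : ℝ → ℝ} {K N A V : ℝ}
    (hs : s.Nonempty) (hβ : 0 < β) (ha : ∀ i, ContDiff ℝ 3 (a i)) (hU : ∀ i ∈ s, 1 ≤ U i)
    (hq : ∀ k, 0 ≤ q k) (hA : 1 ≤ A) (hV : 0 ≤ V) (hd : ∀ k : Fin 4, k ≠ 0 → ∀ i ∈ s,
      |iteratedDeriv k (a i) t| ≤ A * V ^ (k : ℕ) * U i ^ q k)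
    (hg : ContDiff ℝ 3 g) (hK : ∀ k : Fin 4, ∀ x, |iteratedDeriv k g x| ≤ K) (hN : 1 ≤ N) :
    |iteratedDeriv 3 (fun t => g (1 / N * softMin β s (a · t))) t| ≤
      23 * K * (max 1 (β ^ 2) * ((A * V) ^ 3 *
        gibbsMean β s (a · t) (fun i => U i ^ qMax q))) / N := by
  have hQ₁ : 3 * q 1 ≤ qMax q := le_max_left _ _
  have hQ₂ : q 1 + q 2 ≤ qMax q := (le_max_left _ _).trans (le_max_right _ _)
  have hQ₃ : q 3 ≤ qMax q := (le_max_right _ _).trans (le_max_right _ _)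
  have h₁ : ∀ i ∈ s, |deriv (a i) t| ≤ A * V * U i ^ q 1 := by
    simpa using hd 1 (by decide)
  have h₂ : ∀ i ∈ s, |iteratedDeriv 2 (a i) t| ≤ A * V ^ 2 * U i ^ q 2 := hd 2 (by decide)
  have h₃ : ∀ i ∈ s, |iteratedDeriv 3 (a i) t| ≤ A * V ^ 3 * U i ^ q 3 := hd 3 (by decide)
  have hA₃ : A * V ^ 3 ≤ (A * V) ^ 3 := by
    rw [mul_pow]; gcongr; exact le_self_pow₀ hA (by norm_num)
  have hA₂ : A * V * (A * V ^ 2) ≤ (A * V) ^ 3 := by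
    rw [mul_pow, show A * V * (A * V ^ 2) = A ^ 2 * V ^ 3 by ring]
    gcongr
    norm_num
  have hB : 1 ≤ max 1 (β ^ 2) := le_max_left _ _
  have hβB₂ : β ^ 2 ≤ max 1 (β ^ 2) := le_max_right _ _
  have hβB : β ≤ max 1 (β ^ 2) := by nlinarith
  have hΘ : 0 ≤ gibbsMean β s (a · t) (fun i => U i ^ qMax q) := gibbsMean_nonneg fun i hi =>
    Real.rpow_nonneg (zero_le_one.trans (hU i hi)) _
  have hc : 0 ≤ (A * V) ^ 3 := by positivity
  refine abs_iteratedDeriv_three_comp_le hg (contDiff_softMin hs ha) hK hN ?_ ?_ ?_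
  · rw [deriv_softMin hs hβ.ne' ha]
    exact (abs_gibbsMean_pow_three_le hs hU (hq 1) hQ₁ h₁).trans
      (le_mul_of_one_le_left (mul_nonneg hc hΘ) hB)
  · refine (abs_iteratedDeriv_two_softMin_mul_deriv_le hs hβ ha hU (hq 1) (hq 2) hQ₁ hQ₂ h₁
      h₂).trans ?_
    refine (mul_le_mul_of_nonneg_right (?_ : _ ≤ 3 * (max 1 (β ^ 2) * (A * V) ^ 3)) hΘ).trans_eq
      (by ring)
    nlinarith
  · refine (abs_iteratedDeriv_three_softMin_le hs hβ ha hU (hq 1) (hq 2) hQ₁ hQ₂ hQ₃ h₁ h₂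
      h₃).trans ?_
    refine (mul_le_mul_of_nonneg_right (?_ : _ ≤ 13 * (max 1 (β ^ 2) * (A * V) ^ 3)) hΘ).trans_eq
      (by ring)
    nlinarith

end ThirdDerivative

section RowFunctions

variable {κ : Type*} [Fintype κ] {β : ℝ} {s : Finset (κ → ℝ)} {c : (κ → ℝ) → ℝ} {ℓ g : ℝ → ℝ}
  {q : Fin 4 → ℝ} {b : ℕ} {D H K L N : ℝ}

/-- A smooth loss whose derivatives are bounded in terms of its own size, that size having
polynomial growth of order `b`. -/
structure SelfBounded (q : Fin 4 → ℝ) (D H : ℝ) (b : ℕ) (ℓ : ℝ → ℝ) : Prop where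
  contDiff : ContDiff ℝ 3 ℓ
  abs_iteratedDeriv_le : ∀ k : Fin 4, k ≠ 0 → ∀ x,
    |iteratedDeriv k ℓ x| ≤ D * max 1 (ℓ x) ^ q k
  growth : ∀ x, max 1 (ℓ x) ^ qMax q ≤ H * (1 + |x| ^ b)

/-- A bounded `C³` function of a vector whose third derivative at `y + t • z`, `t ∈ [0, 1]`, in
the direction `z` is at most `C (V³ (1 + Y y) + V^(b + 3))`, where `V = L ‖z‖₁`. -/
structure ThirdDerivControl (h Y : (κ → ℝ) → ℝ) (L C : ℝ) (b : ℕ) : Prop where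
  contDiff : ContDiff ℝ 3 h
  bounded : ∃ K, ∀ z, |h z| ≤ K
  abs_iteratedDeriv_le : ∀ y z, ∀ t ∈ Set.Icc (0 : ℝ) 1,
    |iteratedDeriv 3 (fun t => h (y + t • z)) t| ≤
      C * ((L * ∑ j, |z j|) ^ 3 * (1 + Y y) + (L * ∑ j, |z j|) ^ (b + 3))

theorem abs_dotProduct_le_mul_sum {z w : κ → ℝ} (hw : ∀ j, |w j| ≤ L) :
    |z ⬝ᵥ w| ≤ L * ∑ j, |z j| := by
  refine (Finset.abs_sum_le_sum_abs _ _).trans ?_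
  rw [Finset.mul_sum]
  refine Finset.sum_le_sum fun j _ => ?_
  rw [abs_mul, mul_comm]
  exact mul_le_mul_of_nonneg_right (hw j) (abs_nonneg _)

theorem abs_add_pow_le (x y : ℝ) (n : ℕ) : |x + y| ^ n ≤ 2 ^ n * (|x| ^ n + |y| ^ n) :=
  calc |x + y| ^ n ≤ (|x| + |y|) ^ n := by gcongr; exact abs_add_le x y
    _ ≤ 2 ^ (n - 1) * (|x| ^ n + |y| ^ n) := add_pow_le (abs_nonneg x) (abs_nonneg y) n
    _ ≤ 2 ^ n * (|x| ^ n + |y| ^ n) := by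
      gcongr
      exacts [one_le_two, Nat.sub_le n 1]

theorem iteratedDeriv_comp_affine {k : ℕ} (hk : 0 < k) (hℓ : ContDiff ℝ k ℓ) (r x v t : ℝ) :
    iteratedDeriv k (fun t => r + ℓ (x + t * v)) t = v ^ k * iteratedDeriv k ℓ (x + t * v) := by
  have hx : ContDiff ℝ k fun u => ℓ (x + u) := hℓ.comp (contDiff_const.add contDiff_id)
  simp only [iteratedDeriv_const_add hk, mul_comm _ v]
  rw [iteratedDeriv_comp_const_mul hx]
  simp only [iteratedDeriv_comp_const_add]

-- Adding the energy `ℓ` favours the points where `ℓ` is small, hence only lowers the mean.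
theorem SelfBounded.gibbsMean_size_le (hℓ : SelfBounded q D H b ℓ) (hs : s.Nonempty)
    (hβ : 0 ≤ β) (hq : ∀ k, 0 ≤ q k) (hw : ∀ w ∈ s, ∀ j, |w j| ≤ L) (y z : κ → ℝ) {t : ℝ}
    (ht : t ∈ Set.Icc (0 : ℝ) 1) :
    gibbsMean β s (fun w => c w + ℓ (y ⬝ᵥ w + t * (z ⬝ᵥ w)))
        (fun w => max 1 (ℓ (y ⬝ᵥ w + t * (z ⬝ᵥ w))) ^ qMax q) ≤
      H * 2 ^ b * (1 + gibbsMean β s c (fun w => |y ⬝ᵥ w| ^ b) + (L * ∑ j, |z j|) ^ b) := by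
  have hQ : 0 ≤ qMax q := (hq 3).trans ((le_max_right _ _).trans (le_max_right _ _))
  have hH : 0 ≤ H := by
    have := (hℓ.growth 0).trans' (Real.rpow_nonneg (zero_le_one.trans (le_max_left _ _)) _)
    exact nonneg_of_mul_nonneg_left this (by positivity)
  have hmono : MonovaryOn (fun w => max 1 (ℓ (y ⬝ᵥ w + t * (z ⬝ᵥ w))) ^ qMax q)
      (fun w => ℓ (y ⬝ᵥ w + t * (z ⬝ᵥ w))) s := fun w _ w' _ hlt =>
    Real.rpow_le_rpow (by positivity) (max_le_max_left 1 hlt.le) hQ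
  refine (gibbsMean_add_energy_le_of_monovaryOn hs hβ hmono).trans ?_
  set V := L * ∑ j, |z j|
  calc gibbsMean β s c (fun w => max 1 (ℓ (y ⬝ᵥ w + t * (z ⬝ᵥ w))) ^ qMax q)
      ≤ gibbsMean β s c (fun w => H * 2 ^ b * ((1 + V ^ b) + |y ⬝ᵥ w| ^ b)) := by
        refine gibbsMean_mono fun w hws => (hℓ.growth _).trans ?_
        have hV : |t * (z ⬝ᵥ w)| ≤ V := by
          rw [abs_mul, abs_of_nonneg ht.1]
          exact (mul_le_of_le_one_left (abs_nonneg _) ht.2).trans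
            (abs_dotProduct_le_mul_sum (hw w hws))
        have hadd := abs_add_pow_le (y ⬝ᵥ w) (t * (z ⬝ᵥ w)) b
        have hVb : |t * (z ⬝ᵥ w)| ^ b ≤ V ^ b := pow_le_pow_left₀ (abs_nonneg _) hV b
        have h2 : (1 : ℝ) ≤ 2 ^ b := one_le_pow₀ one_le_two
        rw [mul_assoc]
        refine mul_le_mul_of_nonneg_left ?_ hH
        nlinarith
    _ = _ := by
        rw [gibbsMean_const_mul, gibbsMean_add, gibbsMean_const hs]
        ring

theorem SelfBounded.thirdDerivControl (hℓ : SelfBounded q D H b ℓ) (hs : s.Nonempty)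
    (hβ : 0 < β) (hq : ∀ k, 0 ≤ q k) (hD : 1 ≤ D) (hL : 0 ≤ L) (hw : ∀ w ∈ s, ∀ j, |w j| ≤ L)
    (hg : ContDiff ℝ 3 g) (hK : ∀ k : Fin 4, ∀ x, |iteratedDeriv k g x| ≤ K) (hN : 1 ≤ N) :
    ThirdDerivControl (fun z => g (1 / N * softMin β s fun w => c w + ℓ (z ⬝ᵥ w)))
      (fun y => gibbsMean β s c fun w => |y ⬝ᵥ w| ^ b) L
      (23 * K * max 1 (β ^ 2) * D ^ 3 * (H * 2 ^ b) / N) b where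
  contDiff := hg.comp (contDiff_const.mul (contDiff_softMin hs fun w =>
    contDiff_const.add (hℓ.contDiff.comp (ContDiff.sum fun j _ =>
      (contDiff_apply ℝ ℝ j).mul contDiff_const))))
  bounded := ⟨K, fun z => hK 0 _⟩
  abs_iteratedDeriv_le y z t ht := by
    set V := L * ∑ j, |z j|
    have hV : 0 ≤ V := by positivity
    have hK₀ : 0 ≤ K := (abs_nonneg _).trans (hK 0 0)
    simp only [add_dotProduct, smul_dotProduct, smul_eq_mul]
    have hderiv : ∀ k : Fin 4, k ≠ 0 → ∀ w ∈ s,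
        |iteratedDeriv k (fun t => c w + ℓ (y ⬝ᵥ w + t * (z ⬝ᵥ w))) t| ≤
          D * V ^ (k : ℕ) * max 1 (ℓ (y ⬝ᵥ w + t * (z ⬝ᵥ w))) ^ q k := fun k hk w hws => by
      rw [iteratedDeriv_comp_affine (Nat.pos_of_ne_zero (Fin.val_ne_of_ne hk))
        (hℓ.contDiff.of_le (by exact_mod_cast Nat.lt_succ_iff.1 k.2)), abs_mul, abs_pow]
      exact (mul_le_mul (pow_le_pow_left₀ (abs_nonneg _) (abs_dotProduct_le_mul_sum (hw w hws)) _)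
        (hℓ.abs_iteratedDeriv_le k hk _) (abs_nonneg _) (by positivity)).trans_eq (by ring)
    have hthird := abs_iteratedDeriv_three_comp_softMin_le (t := t) hs hβ
      (fun w => contDiff_const.add (hℓ.contDiff.comp
        (contDiff_const.add (contDiff_id.mul contDiff_const))))
      (fun w _ => le_max_left _ _) hq hD hV hderiv hg hK hN
    calc _ ≤ _ := hthird
      _ ≤ 23 * K * (max 1 (β ^ 2) * ((D * V) ^ 3 * (H * 2 ^ b *
          (1 + gibbsMean β s c (fun w => |y ⬝ᵥ w| ^ b) + V ^ b)))) / N := by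
        gcongr
        exact hℓ.gibbsMean_size_le hs hβ.le hq hw y z ht
      _ = _ := by ring

end RowFunctions

section Moments

variable {Ω : Type*} [MeasurableSpace Ω] {μ : Measure Ω} {f : Ω → ℝ} {r k : ℕ}

theorem integrable_pow_of_memLp [IsFiniteMeasure μ] (hf : MemLp f r μ) (hk : k ≤ r) :
    Integrable (fun ω => f ω ^ k) μ := by
  have h : MemLp f k μ := hf.mono_exponent (by exact_mod_cast hk)
  refine (integrable_norm_iff (hf.1.pow k)).1 ?_
  simpa only [Pi.pow_apply, norm_pow] using h.integrable_norm_pow'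

theorem integral_abs_pow_le_of_eLpNorm_le [IsProbabilityMeasure μ] {v : ℝ} (hv : 0 ≤ v)
    (hf : AEStronglyMeasurable f μ) (h : eLpNorm f r μ ≤ ENNReal.ofReal v) (hk : k ≤ r) :
    ∫ ω, |f ω| ^ k ∂μ ≤ v ^ k := by
  rcases Nat.eq_zero_or_pos k with rfl | hk0
  · simp
  have hkr : (k : ℝ≥0∞) ≤ r := by exact_mod_cast hk
  have hfk : MemLp f k μ := (show MemLp f r μ from ⟨hf, h.trans_lt ENNReal.ofReal_lt_top⟩)
    |>.mono_exponent hkr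
  have hk' : (k : ℝ) ≠ 0 := by exact_mod_cast hk0.ne'
  have h0 : 0 ≤ ∫ ω, |f ω| ^ k ∂μ := integral_nonneg fun ω => by positivity
  have hnorm := (eLpNorm_le_eLpNorm_of_exponent_le hkr hf).trans h
  rw [hfk.eLpNorm_eq_integral_rpow_norm (by exact_mod_cast hk0.ne') (ENNReal.natCast_ne_top k),
    ENNReal.ofReal_le_ofReal_iff hv] at hnorm
  simp only [ENNReal.toReal_natCast, Real.rpow_natCast, Real.norm_eq_abs] at hnorm
  have hpow := pow_le_pow_left₀ (Real.rpow_nonneg h0 _) hnorm k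
  rwa [← Real.rpow_natCast, ← Real.rpow_mul h0, inv_mul_cancel₀ hk', Real.rpow_one] at hpow

theorem abs_integral_sub_le_of_approx {ν : Measure Ω} {p R : Ω → ℝ} (hf : Integrable f μ)
    (hf' : Integrable f ν) (hp : Integrable p μ) (hp' : Integrable p ν) (hR : Integrable R μ)
    (hR' : Integrable R ν) (hpp : ∫ ω, p ω ∂μ = ∫ ω, p ω ∂ν) (h : ∀ ω, |f ω - p ω| ≤ R ω) :
    |∫ ω, f ω ∂μ - ∫ ω, f ω ∂ν| ≤ ∫ ω, R ω ∂μ + ∫ ω, R ω ∂ν := by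
  have hsub : ∫ ω, f ω ∂μ - ∫ ω, f ω ∂ν = ∫ ω, (f ω - p ω) ∂μ - ∫ ω, (f ω - p ω) ∂ν := by
    rw [integral_sub hf hp, integral_sub hf' hp', hpp]; ring
  rw [hsub]
  refine (abs_sub _ _).trans (add_le_add ?_ ?_)
  · exact abs_integral_le_integral_abs.trans (integral_mono (hf.sub hp).abs hR h)
  · exact abs_integral_le_integral_abs.trans (integral_mono (hf'.sub hp').abs hR' h)

end Moments

section CenteredLaws

variable {κ : Type*} {μ ν : Measure (κ → ℝ)} {T : Matrix κ κ ℝ} {r : ℕ} {v : κ → ℝ}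

/-- `μ` is the law of a centred random vector with covariance matrix `T` whose `j`-th coordinate
has `L^r`-norm at most `v j`. -/
structure IsCenteredLaw (μ : Measure (κ → ℝ)) (T : Matrix κ κ ℝ) (r : ℕ) (v : κ → ℝ) : Prop where
  mean : ∀ j, ∫ z, z j ∂μ = 0
  secondMoment : ∀ j k, ∫ z, z j * z k ∂μ = T j k
  eLpNorm_le : ∀ j, eLpNorm (fun z : κ → ℝ => z j) r μ ≤ ENNReal.ofReal (v j)

namespace IsCenteredLaw

theorem memLp (h : IsCenteredLaw μ T r v) (j : κ) : MemLp (fun z : κ → ℝ => z j) r μ :=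
  ⟨(measurable_pi_apply j).aestronglyMeasurable, (h.eLpNorm_le j).trans_lt ENNReal.ofReal_lt_top⟩

theorem integrable [IsFiniteMeasure μ] (h : IsCenteredLaw μ T r v) (hr : 1 ≤ r) (j : κ) :
    Integrable (fun z : κ → ℝ => z j) μ := by
  simpa only [pow_one] using integrable_pow_of_memLp (h.memLp j) hr

theorem integrable_mul [IsFiniteMeasure μ] (h : IsCenteredLaw μ T r v) (hr : 2 ≤ r)
    (j k : κ) : Integrable (fun z : κ → ℝ => z j * z k) μ :=
  have h2 : ∀ j, MemLp (fun z : κ → ℝ => z j) 2 μ := fun j =>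
    (h.memLp j).mono_exponent (by exact_mod_cast hr)
  (h2 j).integrable_mul (h2 k)

variable [Fintype κ]

theorem memLp_dotProduct (h : IsCenteredLaw μ T r v) (w : κ → ℝ) :
    MemLp (fun z => z ⬝ᵥ w) r μ :=
  memLp_finsetSum _ fun j _ => (h.memLp j).mul_const (w j)

theorem memLp_sum_abs (h : IsCenteredLaw μ T r v) : MemLp (fun z : κ → ℝ => ∑ j, |z j|) r μ :=
  memLp_finsetSum _ fun j _ => (h.memLp j).norm

variable [IsProbabilityMeasure μ]

theorem integrable_dotProduct (h : IsCenteredLaw μ T r v) (hr : 1 ≤ r) (w : κ → ℝ) :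
    Integrable (fun z => z ⬝ᵥ w) μ :=
  integrable_finsetSum _ fun j _ => (h.integrable hr j).mul_const (w j)

theorem integral_dotProduct (h : IsCenteredLaw μ T r v) (hr : 1 ≤ r) (w : κ → ℝ) :
    ∫ z, z ⬝ᵥ w ∂μ = 0 := by
  simp only [dotProduct]
  rw [integral_finsetSum _ fun j _ => (h.integrable hr j).mul_const _]
  simp only [integral_mul_const, h.mean, zero_mul, Finset.sum_const_zero]

theorem integrable_sum_sum_mul (h : IsCenteredLaw μ T r v) (hr : 2 ≤ r) (A : Matrix κ κ ℝ) :
    Integrable (fun z => ∑ j, ∑ k, A j k * (z j * z k)) μ :=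
  integrable_finsetSum _ fun j _ => integrable_finsetSum _ fun k _ =>
    (h.integrable_mul hr j k).const_mul _

theorem integral_sum_sum_mul (h : IsCenteredLaw μ T r v) (hr : 2 ≤ r) (A : Matrix κ κ ℝ) :
    ∫ z, ∑ j, ∑ k, A j k * (z j * z k) ∂μ = ∑ j, ∑ k, A j k * T j k := by
  have hi := fun j k => (h.integrable_mul hr j k).const_mul (A j k)
  rw [integral_finsetSum _ fun j _ => integrable_finsetSum _ fun k _ => hi j k]
  simp only [integral_finsetSum _ fun k _ => hi _ k, integral_const_mul, h.secondMoment]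

theorem integral_dotProduct_sq (h : IsCenteredLaw μ T r v) (hr : 2 ≤ r) (u : κ → ℝ) :
    ∫ z, (z ⬝ᵥ u) ^ 2 ∂μ = u ⬝ᵥ T *ᵥ u := by
  have hsq : ∀ z : κ → ℝ, (z ⬝ᵥ u) ^ 2 = ∑ j, ∑ k, Matrix.vecMulVec u u j k * (z j * z k) := by
    intro z
    simp only [sq, dotProduct, Finset.sum_mul_sum, Matrix.vecMulVec_apply]
    exact Finset.sum_congr rfl fun j _ => Finset.sum_congr rfl fun k _ => by ring
  rw [integral_congr_ae (.of_forall hsq), h.integral_sum_sum_mul hr]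
  simp only [Matrix.vecMulVec_apply, dotProduct, Matrix.mulVec, Finset.mul_sum]
  exact Finset.sum_congr rfl fun j _ => Finset.sum_congr rfl fun k _ => by ring

theorem integral_sum_abs_pow_le (h : IsCenteredLaw μ T r v) (hv : ∀ j, 0 ≤ v j) {k : ℕ}
    (hr : 1 ≤ r) (hk : k ≤ r) : ∫ z : κ → ℝ, (∑ j, |z j|) ^ k ∂μ ≤ (∑ j, v j) ^ k := by
  have hnorm : eLpNorm (fun z : κ → ℝ => ∑ j, |z j|) r μ ≤ ENNReal.ofReal (∑ j, v j) := by
    have hsum := eLpNorm_sum_le (p := r) (s := Finset.univ) (f := fun j (z : κ → ℝ) => |z j|)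
      (fun j _ => (h.memLp j).norm.aestronglyMeasurable) (by exact_mod_cast hr)
    rw [Finset.sum_fn] at hsum
    rw [ENNReal.ofReal_sum_of_nonneg fun j _ => hv j]
    refine hsum.trans (Finset.sum_le_sum fun j _ => ?_)
    simpa only [← Real.norm_eq_abs, eLpNorm_norm] using h.eLpNorm_le j
  have := integral_abs_pow_le_of_eLpNorm_le (Finset.sum_nonneg fun j _ => hv j)
    h.memLp_sum_abs.aestronglyMeasurable hnorm hk
  simpa only [abs_of_nonneg (Finset.sum_nonneg fun (j : κ) _ => abs_nonneg ((_ : κ → ℝ) j))]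
    using this

theorem integral_dotProduct_pow_le (h : IsCenteredLaw μ T r v) (hv : ∀ j, 0 ≤ v j) {L : ℝ}
    {w : κ → ℝ} (hL : 0 ≤ L) (hw : ∀ j, |w j| ≤ L) {k : ℕ} (hr : 1 ≤ r) (hk : k ≤ r) :
    ∫ z, (z ⬝ᵥ w) ^ k ∂μ ≤ (L * ∑ j, v j) ^ k :=
  calc ∫ z, (z ⬝ᵥ w) ^ k ∂μ ≤ ∫ z, L ^ k * (∑ j, |z j|) ^ k ∂μ := by
        refine integral_mono (integrable_pow_of_memLp (h.memLp_dotProduct w) hk)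
          ((integrable_pow_of_memLp h.memLp_sum_abs hk).const_mul _) fun z => ?_
        rw [← mul_pow]
        exact (le_abs_self _).trans ((abs_pow _ _).trans_le
          (pow_le_pow_left₀ (abs_nonneg _) (abs_dotProduct_le_mul_sum hw) k))
    _ ≤ (L * ∑ j, v j) ^ k := by
        rw [integral_const_mul, mul_pow]
        gcongr
        exact h.integral_sum_abs_pow_le hv hr hk

end IsCenteredLaw

section Swap

variable [Fintype κ] [IsProbabilityMeasure μ] [IsProbabilityMeasure ν] {h Y : (κ → ℝ) → ℝ}
  {L C : ℝ} {b : ℕ}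

theorem deriv_comp_line (hh : ContDiff ℝ 2 h) (y z : κ → ℝ) :
    deriv (fun t : ℝ => h (y + t • z)) 0 = fderiv ℝ h y z ∧
    iteratedDeriv 2 (fun t : ℝ => h (y + t • z)) 0 = fderiv ℝ (fderiv ℝ h) y z z := by
  have hline : ∀ t : ℝ, HasDerivAt (fun t : ℝ => y + t • z) z t := fun t => by
    simpa using ((hasDerivAt_id t).smul_const z).const_add y
  have hd₁ : ∀ t, HasDerivAt (fun t : ℝ => h (y + t • z)) (fderiv ℝ h (y + t • z) z) t := fun t =>
    (hh.differentiable (by norm_num) _).hasFDerivAt.comp_hasDerivAt t (hline t)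
  have hy : HasFDerivAt (fderiv ℝ h) (fderiv ℝ (fderiv ℝ h) y) (y + (0 : ℝ) • z) := by
    rw [zero_smul, add_zero]
    exact ((hh.fderiv_right (m := 1) (by norm_num)).differentiable (by norm_num) y).hasFDerivAt
  have hd₂ : HasDerivAt (fun t : ℝ => fderiv ℝ h (y + t • z) z)
      (fderiv ℝ (fderiv ℝ h) y z z) 0 :=
    (ContinuousLinearMap.apply ℝ ℝ z).hasFDerivAt.comp_hasDerivAt 0
      (hy.comp_hasDerivAt 0 (hline 0))
  rw [iteratedDeriv_succ, iteratedDeriv_one, deriv_eq hd₁, hd₂.deriv]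
  simp only [zero_smul, add_zero, and_self]

theorem exists_quadratic_approx (hh : ContDiff ℝ 3 h) (y : κ → ℝ) :
    ∃ (a : κ → ℝ) (A : Matrix κ κ ℝ), ∀ z K,
      (∀ t ∈ Set.Icc (0 : ℝ) 1, |iteratedDeriv 3 (fun t : ℝ => h (y + t • z)) t| ≤ K) →
      |h (y + z) - (h y + (z ⬝ᵥ a + ∑ j, ∑ k, A j k * (z j * z k)))| ≤ K := by
  classical
  set e : κ → κ → ℝ := fun j k => if j = k then 1 else 0
  refine ⟨fun j => fderiv ℝ h y (e j),
    Matrix.of fun j k => fderiv ℝ (fderiv ℝ h) y (e j) (e k) / 2, fun z K hK => ?_⟩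
  have hz : ∀ F : (κ → ℝ) →L[ℝ] ℝ, F z = ∑ j, z j * F (e j) := fun F =>
    LinearMap.pi_apply_eq_sum_univ F.toLinearMap z
  have hzz : fderiv ℝ (fderiv ℝ h) y z z =
      ∑ j, ∑ k, fderiv ℝ (fderiv ℝ h) y (e j) (e k) * (z j * z k) := by
    rw [← ContinuousLinearMap.flip_apply, hz]
    refine Finset.sum_congr rfl fun j _ => ?_
    rw [ContinuousLinearMap.flip_apply, hz, Finset.mul_sum]
    exact Finset.sum_congr rfl fun k _ => by ring
  have htaylor := abs_taylor_two_sub_le (φ := fun t : ℝ => h (y + t • z))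
    (hh.comp (contDiff_const.add (contDiff_id.smul contDiff_const))) hK
  obtain ⟨hd₁, hd₂⟩ := deriv_comp_line (hh.of_le (by norm_num)) y z
  rw [hd₁, hd₂, hzz, hz] at htaylor
  simp only [one_smul, zero_smul, add_zero, Finset.sum_div] at htaylor
  simpa only [dotProduct, Matrix.of_apply, div_mul_eq_mul_div, add_assoc] using htaylor

theorem ThirdDerivControl.integrable (hh : ThirdDerivControl h Y L C b) (y : κ → ℝ) :
    Integrable (fun z => h (y + z)) μ :=
  let ⟨K, hK⟩ := hh.bounded
  .of_bound (hh.contDiff.continuous.comp (continuous_const.add continuous_id)).aestronglyMeasurable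
    K (.of_forall fun _ => hK _)

theorem ThirdDerivControl.abs_integral_sub_le (hh : ThirdDerivControl h Y L C b)
    (hμ : IsCenteredLaw μ T (b + 3) v) (hν : IsCenteredLaw ν T (b + 3) v) (hv : ∀ j, 0 ≤ v j)
    (hC : 0 ≤ C) (hL : 0 ≤ L) {y : κ → ℝ} (hY : 0 ≤ Y y) :
    |∫ z, h (y + z) ∂μ - ∫ z, h (y + z) ∂ν| ≤
      2 * C * ((L * ∑ j, v j) ^ 3 * (1 + Y y) + (L * ∑ j, v j) ^ (b + 3)) := by
  obtain ⟨a, A, happrox⟩ := exists_quadratic_approx hh.contDiff y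
  have hint : ∀ {lam : Measure (κ → ℝ)} [IsProbabilityMeasure lam],
      IsCenteredLaw lam T (b + 3) v → Integrable (fun z : κ → ℝ =>
        z ⬝ᵥ a + ∑ j, ∑ k, A j k * (z j * z k)) lam ∧
      ∫ z : κ → ℝ, (h y + (z ⬝ᵥ a + ∑ j, ∑ k, A j k * (z j * z k))) ∂lam =
        h y + ∑ j, ∑ k, A j k * T j k := fun hlam => by
    have i₁ := hlam.integrable_dotProduct (by omega) a
    have i₂ := hlam.integrable_sum_sum_mul (by omega) A
    refine ⟨i₁.add i₂, ?_⟩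
    rw [integral_add (integrable_const _) (by exact i₁.add i₂), integral_add i₁ i₂,
      hlam.integral_dotProduct (by omega), hlam.integral_sum_sum_mul (by omega)]
    simp
  set R : (κ → ℝ) → ℝ := fun z =>
    C * ((L * ∑ j, |z j|) ^ 3 * (1 + Y y) + (L * ∑ j, |z j|) ^ (b + 3)) with hR
  have hremainder : ∀ {lam : Measure (κ → ℝ)} [IsProbabilityMeasure lam],
      IsCenteredLaw lam T (b + 3) v → Integrable R lam ∧
      ∫ z, R z ∂lam ≤ C * ((L * ∑ j, v j) ^ 3 * (1 + Y y) + (L * ∑ j, v j) ^ (b + 3)) :=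
    fun hlam => by
      have i : ∀ k ≤ b + 3, Integrable (fun z : κ → ℝ => L ^ k * (∑ j, |z j|) ^ k) _ := fun k hk =>
        (integrable_pow_of_memLp hlam.memLp_sum_abs hk).const_mul _
      have i₃ := (i 3 (by omega)).mul_const (1 + Y y)
      simp only [hR, mul_pow]
      refine ⟨(i₃.add (i _ le_rfl)).const_mul C, ?_⟩
      rw [integral_const_mul, integral_add i₃ (i _ le_rfl), integral_mul_const,
        integral_const_mul, integral_const_mul]
      gcongr
      exacts [hlam.integral_sum_abs_pow_le hv (by omega) (by omega),
        hlam.integral_sum_abs_pow_le hv (by omega) le_rfl]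
  refine (abs_integral_sub_le_of_approx (hh.integrable y) (hh.integrable y)
    ((integrable_const _).add (hint hμ).1) ((integrable_const _).add (hint hν).1)
    (hremainder hμ).1 (hremainder hν).1 ((hint hμ).2.trans (hint hν).2.symm)
    fun z => happrox z _ (hh.abs_iteratedDeriv_le y z)).trans ?_
  linarith [(hremainder hμ).2, (hremainder hν).2]

end Swap

end CenteredLaws

section EvenMoments

theorem pow_mul_pow_le_pow_add_pow {x y : ℝ} (hx : 0 ≤ x) (hy : 0 ≤ y) (i j : ℕ) :
    x ^ i * y ^ j ≤ x ^ (i + j) + y ^ (i + j) := by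
  rcases le_total x y with h | h
  · calc x ^ i * y ^ j ≤ y ^ i * y ^ j := by gcongr
      _ = y ^ (i + j) := (pow_add _ _ _).symm
      _ ≤ _ := le_add_of_nonneg_left (by positivity)
  · calc x ^ i * y ^ j ≤ x ^ i * x ^ j := by gcongr
      _ = x ^ (i + j) := (pow_add _ _ _).symm
      _ ≤ _ := le_add_of_nonneg_right (by positivity)

theorem add_pow_le_second_order (x y : ℝ) (k : ℕ) :
    (x + y) ^ (k + 2) ≤ x ^ (k + 2) + (k + 2) * (x ^ (k + 1) * y) +
      2 ^ (k + 2) * (|x| ^ k * y ^ 2 + |y| ^ (k + 2)) := by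
  have hterm : ∀ i ∈ Finset.range (k + 1),
      y ^ (i + 1 + 1) * x ^ (k - i) ≤ |x| ^ k * y ^ 2 + |y| ^ (k + 2) := fun i hi => by
    have hik : i + (k - i) = k := Nat.add_sub_cancel' (Nat.lt_succ_iff.1 (Finset.mem_range.1 hi))
    calc y ^ (i + 1 + 1) * x ^ (k - i) ≤ |y ^ (i + 1 + 1) * x ^ (k - i)| := le_abs_self _
      _ = (|y| ^ i * |x| ^ (k - i)) * y ^ 2 := by rw [abs_mul, abs_pow, abs_pow, ← sq_abs y]; ring
      _ ≤ (|y| ^ k + |x| ^ k) * y ^ 2 := by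
        gcongr
        simpa only [hik] using pow_mul_pow_le_pow_add_pow (abs_nonneg y) (abs_nonneg x) i (k - i)
      _ = _ := by rw [← sq_abs y]; ring
  have hchoose : ∑ i ∈ Finset.range (k + 1), ((k + 2).choose (i + 1 + 1) : ℝ) ≤ 2 ^ (k + 2) := by
    have h := Nat.sum_range_choose (k + 2)
    rw [Finset.sum_range_succ', Finset.sum_range_succ'] at h
    exact_mod_cast (by omega : ∑ i ∈ Finset.range (k + 1), (k + 2).choose (i + 1 + 1) ≤ 2 ^ (k + 2))
  have hexp : ∀ i, k + 2 - (i + 1 + 1) = k - i := fun i => by omega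
  calc (x + y) ^ (k + 2)
      = x ^ (k + 2) + (k + 2) * (x ^ (k + 1) * y) + ∑ i ∈ Finset.range (k + 1),
          y ^ (i + 1 + 1) * x ^ (k - i) * ((k + 2).choose (i + 1 + 1) : ℝ) := by
        rw [add_comm x y, add_pow, Finset.sum_range_succ', Finset.sum_range_succ']
        simp only [hexp, zero_add, pow_one, pow_zero, Nat.sub_zero, Nat.choose_zero_right,
          Nat.choose_one_right, Nat.cast_one, one_mul, mul_one, Nat.add_succ_sub_one]
        push_cast
        ring
    _ ≤ x ^ (k + 2) + (k + 2) * (x ^ (k + 1) * y) + ∑ i ∈ Finset.range (k + 1),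
          (|x| ^ k * y ^ 2 + |y| ^ (k + 2)) * ((k + 2).choose (i + 1 + 1) : ℝ) := by
        gcongr with i hi
        exact hterm i hi
    _ ≤ _ := by
        rw [← Finset.mul_sum, mul_comm (2 ^ (k + 2))]
        gcongr

variable {Ω ι : Type*} [MeasurableSpace Ω] {P : Measure Ω} [IsProbabilityMeasure P]

theorem integral_add_pow_le_of_indepFun {X Y : Ω → ℝ} {j : ℕ} (hXY : IndepFun X Y P)
    (hX : MemLp X (2 * j + 2 : ℕ) P) (hY : MemLp Y (2 * j + 2 : ℕ) P) (hmean : ∫ ω, Y ω ∂P = 0) :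
    ∫ ω, (X ω + Y ω) ^ (2 * j + 2) ∂P ≤ ∫ ω, X ω ^ (2 * j + 2) ∂P +
      2 ^ (2 * j + 2) * ((∫ ω, X ω ^ (2 * j) ∂P) * ∫ ω, Y ω ^ 2 ∂P +
        ∫ ω, Y ω ^ (2 * j + 2) ∂P) := by
  have hpow : ∀ k l : ℕ, IndepFun (fun ω => X ω ^ k) (fun ω => Y ω ^ l) P := fun k l =>
    hXY.comp (φ := fun x => x ^ k) (ψ := fun x => x ^ l) (by fun_prop) (by fun_prop)
  have hXi : ∀ k ≤ 2 * j + 2, Integrable (fun ω => X ω ^ k) P := fun k hk =>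
    integrable_pow_of_memLp hX hk
  have hYi : ∀ k ≤ 2 * j + 2, Integrable (fun ω => Y ω ^ k) P := fun k hk =>
    integrable_pow_of_memLp hY hk
  have hmul : ∀ k l, k ≤ 2 * j + 2 → l ≤ 2 * j + 2 → Integrable (fun ω => X ω ^ k * Y ω ^ l) P ∧
      ∫ ω, X ω ^ k * Y ω ^ l ∂P = (∫ ω, X ω ^ k ∂P) * ∫ ω, Y ω ^ l ∂P := fun k l hk hl =>
    ⟨(hpow k l).integrable_mul (hXi k hk) (hYi l hl), (hpow k l).integral_fun_mul_eq_mul_integral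
      (hXi k hk).aestronglyMeasurable (hYi l hl).aestronglyMeasurable⟩
  obtain ⟨i₁, e₁⟩ := hmul (2 * j + 1) 1 (by omega) (by omega)
  obtain ⟨i₂, e₂⟩ := hmul (2 * j) 2 (by omega) (by omega)
  simp only [pow_one, hmean, mul_zero] at i₁ e₁
  have i₃ := i₁.const_mul ((2 * j : ℕ) + 2 : ℝ)
  have i₄ := i₂.add (hYi _ le_rfl)
  calc ∫ ω, (X ω + Y ω) ^ (2 * j + 2) ∂P
      ≤ ∫ ω, (X ω ^ (2 * j + 2) + ((2 * j : ℕ) + 2) * (X ω ^ (2 * j + 1) * Y ω) +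
          2 ^ (2 * j + 2) * (X ω ^ (2 * j) * Y ω ^ 2 + Y ω ^ (2 * j + 2))) ∂P := by
        refine integral_mono (integrable_pow_of_memLp (hX.add hY) le_rfl)
          (((hXi _ le_rfl).add i₃).add (i₄.const_mul _)) fun ω => ?_
        have := add_pow_le_second_order (X ω) (Y ω) (2 * j)
        rwa [(even_two_mul j).pow_abs, ((even_two_mul j).add even_two).pow_abs] at this
    _ = _ := by
        rw [integral_add (by exact (hXi _ le_rfl).add i₃) (by exact i₄.const_mul _),
          integral_add (hXi _ le_rfl) i₃, integral_const_mul, e₁, integral_const_mul,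
          integral_add i₂ (hYi _ le_rfl), e₂]
        ring

variable {ξ : ι → Ω → ℝ}

theorem integral_sum_pow_le (hind : iIndepFun ξ P) (hmeas : ∀ a, Measurable (ξ a)) {j : ℕ}
    (hξ : ∀ a, MemLp (ξ a) (2 * j + 2 : ℕ) P) (hmean : ∀ a, ∫ ω, ξ a ω ∂P = 0) {B : ℝ}
    (hB : ∀ S : Finset ι, ∫ ω, (∑ a ∈ S, ξ a ω) ^ (2 * j) ∂P ≤ B) (S : Finset ι) :
    ∫ ω, (∑ a ∈ S, ξ a ω) ^ (2 * j + 2) ∂P ≤ 2 ^ (2 * j + 2) *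
      (B * ∑ a ∈ S, ∫ ω, ξ a ω ^ 2 ∂P + ∑ a ∈ S, ∫ ω, ξ a ω ^ (2 * j + 2) ∂P) := by
  classical
  induction S using Finset.induction_on with
  | empty => simp
  | insert a S ha ih =>
    have hSa : IndepFun (fun ω => ∑ b ∈ S, ξ b ω) (ξ a) P := by
      simpa only [Finset.sum_fn] using hind.indepFun_finsetSum_of_notMem hmeas ha
    have hadd :=
      integral_add_pow_le_of_indepFun hSa (memLp_finsetSum S fun b _ => hξ b) (hξ a) (hmean a)
    have hBS : (∫ ω, (∑ b ∈ S, ξ b ω) ^ (2 * j) ∂P) * ∫ ω, ξ a ω ^ 2 ∂P ≤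
        B * ∫ ω, ξ a ω ^ 2 ∂P :=
      mul_le_mul_of_nonneg_right (hB S) (integral_nonneg fun ω => sq_nonneg _)
    simp only [Finset.sum_insert ha, add_comm (ξ a _)]
    have hp : (0 : ℝ) ≤ 2 ^ (2 * j + 2) := by positivity
    nlinarith [mul_le_mul_of_nonneg_left hBS hp]

theorem two_pow_mul_eight_pow_le (j : ℕ) :
    (2 : ℝ) ^ (2 * j + 2) * (8 ^ (j * j) + 1) ≤ 8 ^ ((j + 1) * (j + 1)) := by
  have hone : (1 : ℝ) ≤ 8 ^ (j * j) := one_le_pow₀ (by norm_num)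
  calc (2 : ℝ) ^ (2 * j + 2) * (8 ^ (j * j) + 1)
      ≤ 2 ^ (2 * j + 2) * (8 ^ (j * j) + 8 ^ (j * j)) := by gcongr
    _ = 2 ^ (2 * j + 3) * 8 ^ (j * j) := by ring
    _ ≤ 2 ^ (3 * (2 * j + 1)) * 8 ^ (j * j) := by
        gcongr
        · norm_num
        · omega
    _ = 8 ^ (2 * j + 1) * 8 ^ (j * j) := by rw [pow_mul]; norm_num
    _ = _ := by ring

theorem integral_sum_even_pow_le [Fintype ι] (hind : iIndepFun ξ P)
    (hmeas : ∀ a, Measurable (ξ a)) {m : ℕ} (hξ : ∀ a, MemLp (ξ a) (2 * m : ℕ) P)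
    (hmean : ∀ a, ∫ ω, ξ a ω ∂P = 0) {W Λ : ℝ} (hΛ : 1 ≤ Λ)
    (hvar : ∑ a, ∫ ω, ξ a ω ^ 2 ∂P ≤ W)
    (hpow : ∀ j, 2 ≤ j → j ≤ m → ∑ a, ∫ ω, ξ a ω ^ (2 * j) ∂P ≤ W ^ j * Λ) (S : Finset ι) :
    ∫ ω, (∑ a ∈ S, ξ a ω) ^ (2 * m) ∂P ≤ 8 ^ (m * m) * W ^ m * Λ := by
  have hW : 0 ≤ W := (Finset.sum_nonneg fun a _ => integral_nonneg fun ω => sq_nonneg _).trans hvar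
  suffices H : ∀ j ≤ m, ∀ S : Finset ι,
      ∫ ω, (∑ a ∈ S, ξ a ω) ^ (2 * j) ∂P ≤ 8 ^ (j * j) * W ^ j * Λ from H m le_rfl S
  intro j
  induction j with
  | zero => simpa using hΛ
  | succ j ih =>
    intro hj S
    have hsub : ∀ k, ∑ a ∈ S, ∫ ω, ξ a ω ^ (2 * k) ∂P ≤ ∑ a, ∫ ω, ξ a ω ^ (2 * k) ∂P := fun k =>
      Finset.sum_le_sum_of_subset_of_nonneg (Finset.subset_univ _) fun a _ _ =>
        integral_nonneg fun ω => (even_two_mul k).pow_nonneg _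
    have hsucc : ∑ a ∈ S, ∫ ω, ξ a ω ^ (2 * (j + 1)) ∂P ≤ W ^ (j + 1) * Λ := by
      refine (hsub _).trans ?_
      rcases Nat.eq_zero_or_pos j with rfl | hj0
      · simpa only [zero_add, mul_one, pow_one] using hvar.trans (le_mul_of_one_le_right hW hΛ)
      · exact hpow (j + 1) (by omega) hj
    calc ∫ ω, (∑ a ∈ S, ξ a ω) ^ (2 * (j + 1)) ∂P
        ≤ 2 ^ (2 * j + 2) * (8 ^ (j * j) * W ^ j * Λ * ∑ a ∈ S, ∫ ω, ξ a ω ^ 2 ∂P +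
            ∑ a ∈ S, ∫ ω, ξ a ω ^ (2 * j + 2) ∂P) :=
          integral_sum_pow_le hind hmeas
            (fun a => (hξ a).mono_exponent (by exact_mod_cast (by omega : 2 * j + 2 ≤ 2 * m)))
            hmean (ih (by omega)) S
      _ ≤ 2 ^ (2 * j + 2) * (8 ^ (j * j) * W ^ j * Λ * W + W ^ (j + 1) * Λ) := by
          gcongr
          · exact (hsub 1).trans hvar
          · exact hsucc
      _ = 2 ^ (2 * j + 2) * (8 ^ (j * j) + 1) * (W ^ (j + 1) * Λ) := by ring
      _ ≤ 8 ^ ((j + 1) * (j + 1)) * (W ^ (j + 1) * Λ) := by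
          gcongr
          exact two_pow_mul_eight_pow_le j
      _ = _ := by ring

end EvenMoments

section Lindeberg

theorem abs_sub_le_sum_of_swap {ι α : Type*} [Fintype ι] [DecidableEq ι] (Φ : (ι → α) → ℝ)
    (μ ν : ι → α) (ε : ι → ℝ)
    (h : ∀ x : ι → α, (∀ a, x a = μ a ∨ x a = ν a) → ∀ a,
      |Φ (Function.update x a (μ a)) - Φ (Function.update x a (ν a))| ≤ ε a) :
    |Φ μ - Φ ν| ≤ ∑ a, ε a := by
  suffices H : ∀ S : Finset ι, |Φ μ - Φ (S.piecewise ν μ)| ≤ ∑ a ∈ S, ε a by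
    simpa only [Finset.piecewise_univ] using H Finset.univ
  intro S
  induction S using Finset.induction_on with
  | empty => simp
  | insert a S ha ih =>
    have hmix : ∀ b, S.piecewise ν μ b = μ b ∨ S.piecewise ν μ b = ν b := fun b => by
      by_cases hb : b ∈ S <;> simp [hb]
    have hswap := h _ hmix a
    rw [Function.update_eq_self_iff.2 (S.piecewise_eq_of_notMem ν μ ha).symm,
      ← Finset.piecewise_insert] at hswap
    rw [Finset.sum_insert ha, add_comm]
    exact (abs_sub_le _ _ _).trans (add_le_add ih hswap)

variable {ι E : Type*} [Fintype ι] [DecidableEq ι] [MeasurableSpace E]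

theorem map_update_prod_eq_pi (μ : ι → Measure E) [∀ a, IsProbabilityMeasure (μ a)]
    (lam : Measure E) [IsProbabilityMeasure lam] (a : ι) :
    ((Measure.pi μ).prod lam).map (fun x : (ι → E) × E => Function.update x.1 a x.2) =
      Measure.pi (Function.update μ a lam) := by
  have : ∀ b, IsProbabilityMeasure (Function.update μ a lam b) := fun b => by
    obtain rfl | hb := eq_or_ne b a
    · simpa
    · simpa [hb] using inferInstanceAs (IsProbabilityMeasure (μ b))
  refine (Measure.pi_eq fun s hs => ?_).symm
  have hpre : (fun x : (ι → E) × E => Function.update x.1 a x.2) ⁻¹' Set.univ.pi s =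
      Set.univ.pi (Function.update s a Set.univ) ×ˢ s a := by
    ext ⟨x, z⟩
    simp only [Set.mem_preimage, Set.mem_univ_pi, Set.mem_prod]
    rw [Function.forall_update_iff (p := fun b y => y ∈ s b),
      Function.forall_update_iff (p := fun b t => x b ∈ t)]
    simp [and_comm]
  rw [Measure.map_apply measurable_update' (MeasurableSet.univ_pi hs), hpre, Measure.prod_prod,
    Measure.pi_pi, ← Finset.mul_prod_erase _ _ (Finset.mem_univ a),
    ← Finset.mul_prod_erase _ (fun b => Function.update μ a lam b (s b)) (Finset.mem_univ a)]
  simp only [Function.update_self, measure_univ, one_mul]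
  rw [mul_comm]
  congr 1
  refine Finset.prod_congr rfl fun b hb => ?_
  rw [Function.update_of_ne (Finset.ne_of_mem_erase hb),
    Function.update_of_ne (Finset.ne_of_mem_erase hb)]

theorem integral_pi_update (μ : ι → Measure E) [∀ a, IsProbabilityMeasure (μ a)]
    (lam : Measure E) [IsProbabilityMeasure lam] (a : ι) {f : (ι → E) → ℝ} (hf : Measurable f)
    {K : ℝ} (hK : ∀ x, |f x| ≤ K) :
    Integrable (fun x => ∫ z, f (Function.update x a z) ∂lam) (Measure.pi μ) ∧
    ∫ x, f x ∂Measure.pi (Function.update μ a lam) =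
      ∫ x, ∫ z, f (Function.update x a z) ∂lam ∂Measure.pi μ := by
  have hint : Integrable (fun x : (ι → E) × E => f (Function.update x.1 a x.2))
      ((Measure.pi μ).prod lam) :=
    .of_bound (hf.comp measurable_update').aestronglyMeasurable K (.of_forall fun _ => hK _)
  refine ⟨hint.integral_prod_left, ?_⟩
  rw [← map_update_prod_eq_pi, integral_map measurable_update'.aemeasurable
    hf.aestronglyMeasurable, integral_prod _ hint]

theorem abs_integral_pi_sub_le_sum (μ ν : ι → Measure E) [∀ a, IsProbabilityMeasure (μ a)]
    [∀ a, IsProbabilityMeasure (ν a)] {f : (ι → E) → ℝ} (hf : Measurable f) {K : ℝ}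
    (hK : ∀ x, |f x| ≤ K) {R : ι → (ι → E) → ℝ} {ε : ι → ℝ}
    (hR : ∀ a x, |∫ z, f (Function.update x a z) ∂μ a - ∫ z, f (Function.update x a z) ∂ν a| ≤
      R a x)
    (hε : ∀ lam : ι → Measure E, (∀ a, lam a = μ a ∨ lam a = ν a) → ∀ a,
      Integrable (R a) (Measure.pi lam) ∧ ∫ x, R a x ∂Measure.pi lam ≤ ε a) :
    |∫ x, f x ∂Measure.pi μ - ∫ x, f x ∂Measure.pi ν| ≤ ∑ a, ε a := by
  refine abs_sub_le_sum_of_swap (fun lam => ∫ x, f x ∂Measure.pi lam) μ ν ε fun lam hlam a => ?_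
  have : ∀ b, IsProbabilityMeasure (lam b) := fun b => by
    obtain h | h := hlam b <;> rw [h] <;> infer_instance
  obtain ⟨hμi, hμ⟩ := integral_pi_update lam (μ a) a hf hK
  obtain ⟨hνi, hν⟩ := integral_pi_update lam (ν a) a hf hK
  obtain ⟨hRi, hRε⟩ := hε lam hlam a
  calc |∫ x, f x ∂Measure.pi (Function.update lam a (μ a)) -
        ∫ x, f x ∂Measure.pi (Function.update lam a (ν a))|
      ≤ ∫ x, |∫ z, f (Function.update x a z) ∂μ a - ∫ z, f (Function.update x a z) ∂ν a|
          ∂Measure.pi lam := by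
        rw [hμ, hν, ← integral_sub hμi hνi]
        exact abs_integral_le_integral_abs
    _ ≤ ∫ x, R a x ∂Measure.pi lam := integral_mono (hμi.sub hνi).abs hRi (hR a)
    _ ≤ ε a := hRε

end Lindeberg

section IndependentSums

variable {κ ι : Type*} [Fintype κ] [Fintype ι] {μ ν : ι → Measure (κ → ℝ)}
  [∀ a, IsProbabilityMeasure (μ a)] [∀ a, IsProbabilityMeasure (ν a)] {T : ι → Matrix κ κ ℝ}
  {v : ι → κ → ℝ}

theorem memLp_eval_dotProduct {r : ℕ} (hμ : ∀ a, IsCenteredLaw (μ a) (T a) r (v a)) (w : κ → ℝ)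
    (a : ι) : MemLp (fun x : ι → κ → ℝ => x a ⬝ᵥ w) r (Measure.pi μ) :=
  ((hμ a).memLp_dotProduct w).comp_measurePreserving (measurePreserving_eval μ a)

theorem integrable_sum_dotProduct_pow {r k : ℕ} (hμ : ∀ a, IsCenteredLaw (μ a) (T a) r (v a))
    (hk : k ≤ r) (w : κ → ℝ) (S : Finset ι) :
    Integrable (fun x : ι → κ → ℝ => |(∑ a ∈ S, x a) ⬝ᵥ w| ^ k) (Measure.pi μ) := by
  have h : MemLp (fun x : ι → κ → ℝ => (∑ a ∈ S, x a) ⬝ᵥ w) r (Measure.pi μ) := by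
    simpa only [sum_dotProduct] using memLp_finsetSum S fun a _ => memLp_eval_dotProduct hμ w a
  exact integrable_pow_of_memLp h.norm hk

theorem integral_sum_dotProduct_pow_le {m : ℕ}
    (hμ : ∀ a, IsCenteredLaw (μ a) (T a) (2 * m + 3) (v a)) (hv : ∀ a j, 0 ≤ v a j) {w : κ → ℝ}
    {L W Λ : ℝ} (hL : 0 ≤ L) (hΛ : 1 ≤ Λ) (hw : ∀ j, |w j| ≤ L)
    (hvar : ∑ a, w ⬝ᵥ T a *ᵥ w ≤ W)
    (hpow : ∀ j, 2 ≤ j → j ≤ m → ∑ a, (L * ∑ i, v a i) ^ (2 * j) ≤ W ^ j * Λ) (S : Finset ι) :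
    ∫ x : ι → κ → ℝ, |(∑ a ∈ S, x a) ⬝ᵥ w| ^ (2 * m) ∂Measure.pi μ ≤
      8 ^ (m * m) * W ^ m * Λ := by
  have hdot : Measurable fun z : κ → ℝ => z ⬝ᵥ w := by unfold dotProduct; fun_prop
  have heval : ∀ a k, ∫ x : ι → κ → ℝ, (x a ⬝ᵥ w) ^ k ∂Measure.pi μ = ∫ z, (z ⬝ᵥ w) ^ k ∂μ a :=
    fun a k =>
    integral_comp_eval (μ := μ) (f := fun z => (z ⬝ᵥ w) ^ k) (hdot.pow_const k).aestronglyMeasurable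
  simp only [(even_two_mul m).pow_abs, sum_dotProduct]
  refine integral_sum_even_pow_le (iIndepFun_pi fun a => hdot.aemeasurable)
    (fun a => hdot.comp (measurable_pi_apply a))
    (fun a => (memLp_eval_dotProduct hμ w a).mono_exponent (by gcongr; omega))
    (fun a => ?_) hΛ ?_ (fun j h2j hj => ?_) S
  · simpa only [pow_one, (hμ a).integral_dotProduct (by omega)] using heval a 1
  · simpa only [heval, (hμ _).integral_dotProduct_sq (by omega : 2 ≤ 2 * m + 3)] using hvar
  · simp only [heval]
    exact (Finset.sum_le_sum fun a _ => (hμ a).integral_dotProduct_pow_le (hv a) hL hw (by omega)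
      (by omega)).trans (hpow j h2j hj)

theorem integral_gibbsMean {Ω α : Type*} [MeasurableSpace Ω] {P : Measure Ω} {β : ℝ}
    {s : Finset α} {c : α → ℝ} {f : Ω → α → ℝ} (hf : ∀ w ∈ s, Integrable (fun ω => f ω w) P) :
    Integrable (fun ω => gibbsMean β s c (f ω)) P ∧
    ∫ ω, gibbsMean β s c (f ω) ∂P = gibbsMean β s c fun w => ∫ ω, f ω w ∂P := by
  have hi := fun w hw => (hf w hw).const_mul (Real.exp (-β * c w))
  simp only [gibbsMean_eq_div]
  refine ⟨(integrable_finsetSum _ hi).div_const _, ?_⟩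
  rw [integral_div, integral_finsetSum _ hi]
  simp only [integral_const_mul]

theorem ThirdDerivControl.abs_integral_sum_sub_le {m : ℕ} {β L W Λ C : ℝ} {s : Finset (κ → ℝ)}
    {c : (κ → ℝ) → ℝ} {h : (κ → ℝ) → ℝ}
    (hh : ThirdDerivControl h (fun y => gibbsMean β s c fun w => |y ⬝ᵥ w| ^ (2 * m)) L C (2 * m))
    (hμ : ∀ a, IsCenteredLaw (μ a) (T a) (2 * m + 3) (v a))
    (hν : ∀ a, IsCenteredLaw (ν a) (T a) (2 * m + 3) (v a)) (hv : ∀ a j, 0 ≤ v a j)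
    (hC : 0 ≤ C) (hL : 0 ≤ L) (hΛ : 1 ≤ Λ) (hs : s.Nonempty) (hw : ∀ w ∈ s, ∀ j, |w j| ≤ L)
    (hvar : ∀ w ∈ s, ∑ a, w ⬝ᵥ T a *ᵥ w ≤ W)
    (hpow : ∀ j, 2 ≤ j → j ≤ m → ∑ a, (L * ∑ i, v a i) ^ (2 * j) ≤ W ^ j * Λ) :
    |∫ x : ι → κ → ℝ, h (∑ a, x a) ∂Measure.pi μ - ∫ x : ι → κ → ℝ, h (∑ a, x a) ∂Measure.pi ν| ≤
      ∑ a, 2 * C * ((L * ∑ j, v a j) ^ 3 * (1 + 8 ^ (m * m) * W ^ m * Λ) +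
        (L * ∑ j, v a j) ^ (2 * m + 3)) := by
  classical
  obtain ⟨K, hK⟩ := hh.bounded
  set Y : (κ → ℝ) → ℝ := fun y => gibbsMean β s c fun w => |y ⬝ᵥ w| ^ (2 * m)
  have hupdate : ∀ (a : ι) (x : ι → κ → ℝ) z,
      ∑ b, Function.update x a z b = ∑ b ∈ Finset.univ.erase a, x b + z := fun a x z => by
    rw [Finset.sum_update_of_mem (Finset.mem_univ a), add_comm, Finset.sdiff_singleton_eq_erase]
  refine abs_integral_pi_sub_le_sum μ ν
    (hh.contDiff.continuous.comp
      (by fun_prop : Continuous fun x : ι → κ → ℝ => ∑ a, x a)).measurable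
    (fun x => hK _) (R := fun a x => 2 * C * ((L * ∑ j, v a j) ^ 3 *
      (1 + Y (∑ b ∈ Finset.univ.erase a, x b)) + (L * ∑ j, v a j) ^ (2 * m + 3)))
    (fun a x => ?_) fun lam hlam a => ?_
  · simp only [Function.comp_apply, hupdate]
    exact hh.abs_integral_sub_le (hμ a) (hν a) (hv a) hC hL
      (gibbsMean_nonneg fun w _ => by positivity)
  have : ∀ b, IsProbabilityMeasure (lam b) := fun b => by
    obtain h_eq | h_eq := hlam b <;> rw [h_eq] <;> infer_instance
  have hlaw : ∀ b, IsCenteredLaw (lam b) (T b) (2 * m + 3) (v b) := fun b => by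
    obtain h_eq | h_eq := hlam b <;> rw [h_eq]
    exacts [hμ b, hν b]
  obtain ⟨hYi, hY⟩ := integral_gibbsMean (β := β) (c := c) (s := s) fun w _ =>
    integrable_sum_dotProduct_pow hlaw (by omega : 2 * m ≤ 2 * m + 3) w (Finset.univ.erase a)
  have hYle : ∫ x : ι → κ → ℝ, Y (∑ b ∈ Finset.univ.erase a, x b) ∂Measure.pi lam ≤
      8 ^ (m * m) * W ^ m * Λ := by
    rw [hY, ← gibbsMean_const (β := β) (x := c) hs (8 ^ (m * m) * W ^ m * Λ)]
    exact gibbsMean_mono fun w hws =>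
      integral_sum_dotProduct_pow_le hlaw hv hL hΛ (hw w hws) (hvar w hws) hpow _
  have hv₀ : 0 ≤ ∑ j, v a j := Finset.sum_nonneg fun j _ => hv a j
  have hi := ((integrable_const 1).add hYi).const_mul ((L * ∑ j, v a j) ^ 3)
  refine ⟨(hi.add (integrable_const _)).const_mul _, ?_⟩
  rw [integral_const_mul, integral_add (by exact hi) (integrable_const _), integral_const_mul,
    integral_add (integrable_const _) (by exact hYi)]
  simp only [integral_const, probReal_univ, smul_eq_mul, one_mul]
  gcongr

end IndependentSums

section Independence

variable {Ω E ι : Type*} [MeasurableSpace Ω] [MeasurableSpace E] {P : Measure Ω}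
  [IsProbabilityMeasure P]

theorem iIndepFun_map_iff {F : ι → Type*} [∀ a, MeasurableSpace (F a)] {Z : Ω → E}
    (hZ : Measurable Z) {f : ∀ a, E → F a} (hf : ∀ a, Measurable (f a)) :
    iIndepFun f (P.map Z) ↔ iIndepFun (fun a ω => f a (Z ω)) P := by
  have : IsProbabilityMeasure (P.map Z) := Measure.isProbabilityMeasure_map hZ.aemeasurable
  rw [iIndepFun_iff_map_fun_eq_infinitePi_map hf,
    iIndepFun_iff_map_fun_eq_infinitePi_map (X := fun a ω => f a (Z ω)) fun a => (hf a).comp hZ,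
    Measure.map_map (measurable_pi_lambda _ hf) hZ]
  simp only [Measure.map_map (hf _) hZ]
  rfl

end Independence

section Blocks

variable {κ ι : Type*} [DecidableEq ι] {μ : Measure (κ → ℝ)} {T : Matrix κ κ ℝ} {r : ℕ}
  {v : κ → ℝ}

/-- The part of the vector `x` supported on the cell `c ⁻¹' {a}` of the partition of the
coordinates into the fibres of `c`. -/
def blockPart (c : κ → ι) (a : ι) (x : κ → ℝ) : κ → ℝ := fun j => if c j = a then x j else 0

/-- The diagonal block of the matrix `T` on the cell `c ⁻¹' {a}`, extended by zero. -/
def blockMatrix (c : κ → ι) (a : ι) (T : Matrix κ κ ℝ) : Matrix κ κ ℝ :=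
  .of fun j k => if c j = a ∧ c k = a then T j k else 0

/-- Under the law `μ` the subvectors indexed by the fibres of `c` are independent. -/
def IsBlockIndep (μ : Measure (κ → ℝ)) (c : κ → ι) : Prop :=
  iIndepFun (fun a x => blockPart c a x) μ

theorem measurable_blockPart (c : κ → ι) (a : ι) : Measurable (blockPart c a) :=
  measurable_pi_lambda _ fun j => by
    unfold blockPart
    split_ifs
    exacts [measurable_pi_apply j, measurable_const]

theorem blockPart_apply_self (c : κ → ι) (x : κ → ℝ) (j : κ) : blockPart c (c j) x j = x j :=
  if_pos rfl

theorem sum_blockPart [Fintype ι] (c : κ → ι) (x : κ → ℝ) : ∑ a, blockPart c a x = x := by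
  funext j
  simp [blockPart]

theorem dotProduct_blockMatrix_mulVec [Fintype κ] (c : κ → ι) (a : ι) (w : κ → ℝ) :
    w ⬝ᵥ blockMatrix c a T *ᵥ w = blockPart c a w ⬝ᵥ T *ᵥ blockPart c a w := by
  simp only [dotProduct, Matrix.mulVec, blockMatrix, Matrix.of_apply, blockPart, Finset.mul_sum]
  refine Finset.sum_congr rfl fun j _ => Finset.sum_congr rfl fun k _ => ?_
  by_cases hj : c j = a <;> by_cases hk : c k = a <;> simp [hj, hk]

theorem sum_blockPart_dotProduct_self [Fintype κ] [Fintype ι] (c : κ → ι) (w : κ → ℝ) :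
    ∑ a, blockPart c a w ⬝ᵥ blockPart c a w = w ⬝ᵥ w := by
  simp only [dotProduct]
  rw [Finset.sum_comm]
  exact Finset.sum_congr rfl fun j _ => by simp [blockPart]

theorem IsBlockIndep.integral_eq [Fintype ι] [IsProbabilityMeasure μ] {c : κ → ι}
    (h : IsBlockIndep μ c) {f : (κ → ℝ) → ℝ} (hf : Measurable f) :
    ∫ z, f z ∂μ = ∫ x : ι → κ → ℝ, f (∑ a, x a) ∂Measure.pi fun a => μ.map (blockPart c a) := by
  have hm : ∀ a, Measurable (blockPart c a) := measurable_blockPart c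
  have hsum : Measurable fun x : ι → κ → ℝ => f (∑ a, x a) := hf.comp (by fun_prop)
  rw [← h.map_fun_eq_pi_map fun a => (hm a).aemeasurable,
    integral_map (measurable_pi_lambda _ hm).aemeasurable hsum.aestronglyMeasurable]
  simp only [sum_blockPart]

theorem IsCenteredLaw.map_blockPart (h : IsCenteredLaw μ T r v) (c : κ → ι) (a : ι) :
    IsCenteredLaw (μ.map (blockPart c a)) (blockMatrix c a T) r (blockPart c a v) := by
  have hint : ∀ {f : (κ → ℝ) → ℝ}, Measurable f →
      ∫ z, f z ∂μ.map (blockPart c a) = ∫ z, f (blockPart c a z) ∂μ := fun hf =>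
    integral_map (measurable_blockPart c a).aemeasurable hf.aestronglyMeasurable
  refine ⟨fun j => ?_, fun j k => ?_, fun j => ?_⟩
  · rw [hint (measurable_pi_apply j)]
    by_cases hj : c j = a <;> simp [blockPart, hj, h.mean]
  · rw [hint (by fun_prop : Measurable fun z : κ → ℝ => z j * z k)]
    by_cases hj : c j = a <;> by_cases hk : c k = a <;>
      simp [blockPart, blockMatrix, hj, hk, h.secondMoment]
  · rw [eLpNorm_map_measure (measurable_pi_apply j).aestronglyMeasurable
      (measurable_blockPart c a).aemeasurable]
    by_cases hj : c j = a
    · simpa [Function.comp_def, blockPart, hj] using h.eLpNorm_le j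
    · simp [Function.comp_def, blockPart, hj]

theorem IsCenteredLaw.secondMoment_eq_zero (h : IsCenteredLaw μ T r v) {c : κ → ι}
    (hc : IsBlockIndep μ c) {j k : κ} (hjk : c j ≠ c k) : T j k = 0 := by
  have hindep := (hc.indepFun hjk).comp (measurable_pi_apply j) (measurable_pi_apply k)
  simp only [Function.comp_def, blockPart_apply_self] at hindep
  rw [← h.secondMoment, hindep.integral_fun_mul_eq_mul_integral
    (measurable_pi_apply j).aestronglyMeasurable (measurable_pi_apply k).aestronglyMeasurable,
    h.mean, zero_mul]

end Blocks

section Decoupling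

variable {κ ι ι' : Type*} {μ ν : Measure (κ → ℝ)} [IsProbabilityMeasure μ] {T : Matrix κ κ ℝ}
  {r : ℕ} {v : κ → ℝ} {c : κ → ι} {c' : κ → ι'}

/-- The law of the random vector whose subvectors on the intersections of the cells of two
partitions are taken from independent vectors with law `μ`. -/
def decouple (μ : Measure (κ → ℝ)) [IsProbabilityMeasure μ] (c : κ → ι) (c' : κ → ι') :
    Measure (κ → ℝ) :=
  (Measure.infinitePi fun _ : ι × ι' => μ).map fun x j => x (c j, c' j) j

theorem measurable_decouple (c : κ → ι) (c' : κ → ι') :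
    Measurable fun (x : ι × ι' → κ → ℝ) j => x (c j, c' j) j := by
  fun_prop

instance isProbabilityMeasure_decouple : IsProbabilityMeasure (decouple μ c c') :=
  Measure.isProbabilityMeasure_map (measurable_decouple c c').aemeasurable

theorem isBlockIndep_decouple_left [DecidableEq ι] : IsBlockIndep (decouple μ c c') c := by
  rw [IsBlockIndep, decouple, iIndepFun_map_iff (measurable_decouple c c') (measurable_blockPart c),
    ← Measure.infinitePi_map_curry_symm fun (_ : ι) (_ : ι') => μ,
    iIndepFun_map_iff (by fun_prop)
      (f := fun a (x : ι × ι' → κ → ℝ) => blockPart c a fun j => x (c j, c' j) j)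
      fun a => (measurable_blockPart c a).comp (by fun_prop)]
  have h := iIndepFun_infinitePi (P := fun _ : ι => Measure.infinitePi fun _ : ι' => μ)
    (X := fun a y => blockPart c a fun j => y (c' j) j)
    fun a => (measurable_blockPart c a).comp (by fun_prop)
  convert h using 3 with a x
  funext j
  simp only [blockPart]
  split_ifs with hj
  · rw [← hj]; rfl
  · rfl

theorem decouple_comm : decouple μ c c' = decouple μ c' c := by
  rw [decouple, ← Measure.infinitePi_map_piCongrLeft _ (Equiv.prodComm ι' ι),
    Measure.map_map (measurable_decouple c c') (by fun_prop)]
  rfl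

theorem isBlockIndep_decouple_right [DecidableEq ι'] : IsBlockIndep (decouple μ c c') c' := by
  rw [decouple_comm]
  exact isBlockIndep_decouple_left

theorem IsCenteredLaw.decouple (h : IsCenteredLaw μ T r v)
    (hc : ∀ j k, c j ≠ c k → T j k = 0) (hc' : ∀ j k, c' j ≠ c' k → T j k = 0) :
    IsCenteredLaw (decouple μ c c') T r v := by
  have heval := measurePreserving_eval_infinitePi fun _ : ι × ι' => μ
  have hm := (measurable_decouple c c').aemeasurable (μ := Measure.infinitePi fun _ => μ)
  have hmeas : ∀ a i, Measurable fun x : ι × ι' → κ → ℝ => x a i := fun a i =>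
    (measurable_pi_apply i).comp (measurable_pi_apply a)
  have hint : ∀ a {f : (κ → ℝ) → ℝ}, Measurable f →
      ∫ x, f (x a) ∂Measure.infinitePi (fun _ : ι × ι' => μ) = ∫ z, f z ∂μ := fun a f hf => by
    rw [← integral_map (heval a).measurable.aemeasurable hf.aestronglyMeasurable, (heval a).map_eq]
  refine ⟨fun j => ?_, fun j k => ?_, fun j => ?_⟩
  · rw [BlockUniversality.decouple, integral_map hm (measurable_pi_apply j).aestronglyMeasurable,
      hint _ (measurable_pi_apply j), h.mean]
  · have hjk₂ : Measurable fun z : κ → ℝ => z j * z k := by fun_prop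
    rw [BlockUniversality.decouple, integral_map hm hjk₂.aestronglyMeasurable]
    by_cases hjk : (c j, c' j) = (c k, c' k)
    · simp only [hjk]
      rw [hint (c k, c' k) hjk₂, h.secondMoment]
    · have hT : T j k = 0 := by
        by_cases hcjk : c j = c k
        · exact hc' j k fun hcjk' => hjk (Prod.ext hcjk hcjk')
        · exact hc j k hcjk
      have hindep := (iIndepFun_infinitePi (P := fun _ : ι × ι' => μ) (X := fun _ z => z)
        fun _ => measurable_id).indepFun hjk |>.comp (measurable_pi_apply j) (measurable_pi_apply k)
      simp only [Function.comp_def] at hindep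
      rw [hT, hindep.integral_fun_mul_eq_mul_integral
        (hmeas _ j).aestronglyMeasurable (hmeas _ k).aestronglyMeasurable,
        hint _ (measurable_pi_apply j), h.mean, zero_mul]
  · rw [BlockUniversality.decouple, eLpNorm_map_measure
      (measurable_pi_apply j).aestronglyMeasurable hm]
    exact (eLpNorm_comp_measurePreserving (measurable_pi_apply j).aestronglyMeasurable
      (heval (c j, c' j))).trans_le (h.eLpNorm_le j)

end Decoupling

section BlockCard

variable {κ ι : Type*} [Fintype κ] [DecidableEq ι] (c : κ → ι)

/-- The cardinality of the cell `c ⁻¹' {a}`. -/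
def blockCard (a : ι) : ℕ := (Finset.univ.filter fun j => c j = a).card

theorem blockCard_le_card (a : ι) : blockCard c a ≤ Fintype.card κ :=
  Finset.card_le_univ _

theorem sum_blockCard [Fintype ι] : ∑ a, blockCard c a = Fintype.card κ :=
  Finset.card_eq_sum_card_fiberwise (fun j _ => Finset.mem_univ (c j)) |>.symm

theorem sum_blockPart_const (a : ι) (t : ℝ) :
    ∑ j, blockPart c a (fun _ => t) j = blockCard c a * t := by
  simp [blockPart, blockCard, ← Finset.sum_filter]

theorem sum_blockCard_pow_le [Fintype ι] {d : ℕ} (hd : ∀ a, blockCard c a ≤ d) (k : ℕ) :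
    ∑ a, (blockCard c a : ℝ) ^ (k + 1) ≤ Fintype.card κ * (d : ℝ) ^ k := by
  rw [← sum_blockCard c, Nat.cast_sum, Finset.sum_mul]
  gcongr with a
  rw [pow_succ']
  gcongr
  exact_mod_cast hd a

end BlockCard

theorem sigmaRate_two_mul (m n p d : ℕ) : sigmaRate (2 * m) n p d =
    p * (d : ℝ) ^ (m + 3) / √n ^ 5 + p * (d : ℝ) ^ 2 / √n ^ 3 +
      p * (d : ℝ) ^ (2 * m + 2) / √n ^ (2 * m + 3) := by
  have hsqrt : ∀ k : ℕ, √(n : ℝ) ^ k = (n : ℝ) ^ ((k : ℝ) / 2) := fun k => by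
    rw [Real.sqrt_eq_rpow, ← Real.rpow_natCast, ← Real.rpow_mul (Nat.cast_nonneg n)]
    congr 1
    ring
  have hd : (d : ℝ) ^ (3 + ((2 * m : ℕ) : ℝ) / 2) = (d : ℝ) ^ (m + 3) := by
    rw [← Real.rpow_natCast]
    congr 1
    push_cast
    ring
  rw [sigmaRate, hd, hsqrt, hsqrt, hsqrt]
  push_cast
  rfl

theorem sigmaRate_nonneg (b n p d : ℕ) : 0 ≤ sigmaRate b n p d := by
  unfold sigmaRate
  positivity

section CommonPartition

variable {κ ι : Type*} [Fintype κ] [DecidableEq ι] [Fintype ι] {c : κ → ι} {d m n : ℕ} {B L : ℝ}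

theorem sum_blockCard_mul_pow_le (hd : ∀ a, blockCard c a ≤ d) (k : ℕ) {t : ℝ} (ht : 0 ≤ t) :
    ∑ a, (t * blockCard c a) ^ (k + 1) ≤ t ^ (k + 1) * (Fintype.card κ * (d : ℝ) ^ k) := by
  simp only [mul_pow]
  rw [← Finset.mul_sum]
  gcongr
  exact sum_blockCard_pow_le c hd k

theorem sum_blockCard_mul_even_pow_le (hd : ∀ a, blockCard c a ≤ d) (hn : 0 < n) (hB : 1 ≤ B)
    (hκ : Fintype.card κ ≤ B * n) {j : ℕ} (h2j : 2 ≤ j) (hj : j ≤ m) :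
    ∑ a, (L * (B / √n) * blockCard c a) ^ (2 * j) ≤
      (L ^ 2 * B ^ 3) ^ j * (1 + (d : ℝ) ^ (m + 1) / n) := by
  obtain ⟨i, rfl⟩ := Nat.exists_eq_add_of_le h2j
  have hn' : (0 : ℝ) < n := Nat.cast_pos.2 hn
  have hsq : √(n : ℝ) ^ 2 = n := Real.sq_sqrt hn'.le
  have hdm : (d : ℝ) ^ (i + 3) ≤ (d : ℝ) ^ (m + 1) := by
    obtain rfl | hd₀ := Nat.eq_zero_or_pos d
    · simp
    · exact pow_le_pow_right₀ (by exact_mod_cast hd₀) (by omega)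
  have hcard : ∑ a, (blockCard c a : ℝ) ^ (2 * (2 + i)) ≤
      (B * n) ^ i * (B * n * (d : ℝ) ^ (m + 1)) := by
    calc ∑ a, (blockCard c a : ℝ) ^ (2 * (2 + i))
        = ∑ a, (blockCard c a : ℝ) ^ i * (blockCard c a : ℝ) ^ (i + 3 + 1) :=
          Finset.sum_congr rfl fun a _ => by ring
      _ ≤ ∑ a, (Fintype.card κ : ℝ) ^ i * (blockCard c a : ℝ) ^ (i + 3 + 1) := by
          gcongr with a
          exact blockCard_le_card c a
      _ ≤ (Fintype.card κ : ℝ) ^ i * (Fintype.card κ * (d : ℝ) ^ (i + 3)) := by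
          rw [← Finset.mul_sum]
          gcongr
          exact sum_blockCard_pow_le c hd _
      _ ≤ _ := by gcongr
  calc ∑ a, (L * (B / √n) * blockCard c a) ^ (2 * (2 + i))
      = (L ^ 2 * B ^ 2 / n) ^ (2 + i) * ∑ a, (blockCard c a : ℝ) ^ (2 * (2 + i)) := by
        rw [Finset.mul_sum]
        refine Finset.sum_congr rfl fun a _ => ?_
        rw [mul_pow, pow_mul (L * _), mul_pow L, div_pow B, hsq, mul_div_assoc]
    _ ≤ (L ^ 2 * B ^ 2 / n) ^ (2 + i) * ((B * n) ^ i * (B * n * (d : ℝ) ^ (m + 1))) := by gcongr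
    _ = (L ^ 2 * B ^ 2) ^ (2 + i) * B ^ (i + 1) * ((d : ℝ) ^ (m + 1) / n) := by
        rw [div_pow, mul_pow B]
        field_simp
        ring
    _ ≤ (L ^ 2 * B ^ 2) ^ (2 + i) * B ^ (2 + i) * (1 + (d : ℝ) ^ (m + 1) / n) := by
        gcongr ?_ * ?_ * ?_
        · exact pow_le_pow_right₀ hB (by omega)
        · linarith
    _ = _ := by rw [← mul_pow]; ring

theorem sum_blockCard_error_le (hd : ∀ a, blockCard c a ≤ d) (hn : 0 < n) (hB : 1 ≤ B)
    (hL : 1 ≤ L) :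
    ∑ a, ((L * (B / √n) * blockCard c a) ^ 3 *
        (1 + 8 ^ (m * m) * (L ^ 2 * B ^ 3) ^ m * (1 + (d : ℝ) ^ (m + 1) / n)) +
      (L * (B / √n) * blockCard c a) ^ (2 * m + 3)) ≤
      2 * 8 ^ (m * m) * B ^ (5 * m + 3) * L ^ (2 * m + 3) *
        sigmaRate (2 * m) n (Fintype.card κ) d := by
  set r := √(n : ℝ)
  have hr : 0 < r := Real.sqrt_pos.2 (Nat.cast_pos.2 hn)
  have hrn : (n : ℝ) = r ^ 2 := (Real.sq_sqrt n.cast_nonneg).symm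
  set p : ℝ := ↑(Fintype.card κ)
  set E : ℝ := 8 ^ (m * m)
  have hE : 1 ≤ E := one_le_pow₀ (by norm_num)
  set Λ : ℝ := 1 + (d : ℝ) ^ (m + 1) / n with hΛ_def
  have hΛ : 1 ≤ Λ := le_add_of_nonneg_right (by positivity)
  have hvar : 1 + E * (L ^ 2 * B ^ 3) ^ m * Λ ≤ 2 * E * B ^ (3 * m) * L ^ (2 * m) * Λ := by
    have hW : 1 ≤ (L ^ 2 * B ^ 3) ^ m :=
      one_le_pow₀ (one_le_mul_of_one_le_of_one_le (one_le_pow₀ hL) (one_le_pow₀ hB))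
    have h1 : 1 ≤ E * (L ^ 2 * B ^ 3) ^ m * Λ :=
      one_le_mul_of_one_le_of_one_le (one_le_mul_of_one_le_of_one_le hE hW) hΛ
    calc 1 + E * (L ^ 2 * B ^ 3) ^ m * Λ ≤ 2 * (E * (L ^ 2 * B ^ 3) ^ m * Λ) := by linarith
      _ = _ := by rw [mul_pow, ← pow_mul, ← pow_mul]; ring
  rw [Finset.sum_add_distrib, ← Finset.sum_mul, sigmaRate_two_mul]
  calc _ ≤ (L * (B / r)) ^ 3 * (p * (d : ℝ) ^ 2) * (2 * E * B ^ (3 * m) * L ^ (2 * m) * Λ) +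
        (L * (B / r)) ^ (2 * m + 3) * (p * (d : ℝ) ^ (2 * m + 2)) := by
        gcongr
        · exact sum_blockCard_mul_pow_le hd 2 (by positivity)
        · exact sum_blockCard_mul_pow_le hd (2 * m + 2) (by positivity)
    _ = 2 * E * B ^ (3 * m + 3) * L ^ (2 * m + 3) *
          (p * (d : ℝ) ^ (m + 3) / r ^ 5 + p * (d : ℝ) ^ 2 / r ^ 3) +
        1 * B ^ (2 * m + 3) * L ^ (2 * m + 3) * (p * (d : ℝ) ^ (2 * m + 2) / r ^ (2 * m + 3)) := by
        simp only [hΛ_def, hrn, mul_pow, div_pow]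
        field_simp
        ring
    _ ≤ 2 * E * B ^ (5 * m + 3) * L ^ (2 * m + 3) *
          (p * (d : ℝ) ^ (m + 3) / r ^ 5 + p * (d : ℝ) ^ 2 / r ^ 3) +
        2 * E * B ^ (5 * m + 3) * L ^ (2 * m + 3) *
          (p * (d : ℝ) ^ (2 * m + 2) / r ^ (2 * m + 3)) := by
        gcongr <;> first | omega | linarith
    _ = _ := by ring

theorem sum_dotProduct_blockMatrix_mulVec_le {T : Matrix κ κ ℝ} (hn : 0 < n) (hB : 1 ≤ B)
    (hκ : Fintype.card κ ≤ B * n) (hT : ∀ u, u ⬝ᵥ T *ᵥ u ≤ B / n * (u ⬝ᵥ u)) {w : κ → ℝ}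
    (hw : ∀ j, |w j| ≤ L) : ∑ a, w ⬝ᵥ blockMatrix c a T *ᵥ w ≤ L ^ 2 * B ^ 3 := by
  have hww : w ⬝ᵥ w ≤ B * n * L ^ 2 := by
    calc w ⬝ᵥ w ≤ ∑ _j : κ, L ^ 2 := Finset.sum_le_sum fun j _ => by
          rw [← sq, ← sq_abs]
          exact pow_le_pow_left₀ (abs_nonneg _) (hw j) 2
      _ ≤ B * n * L ^ 2 := by
          rw [Finset.sum_const, nsmul_eq_mul, Finset.card_univ]
          gcongr
  have : (0 : ℝ) < n := Nat.cast_pos.2 hn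
  calc ∑ a, w ⬝ᵥ blockMatrix c a T *ᵥ w
      ≤ ∑ a, B / n * (blockPart c a w ⬝ᵥ blockPart c a w) := by
        gcongr with a
        rw [dotProduct_blockMatrix_mulVec]
        exact hT _
    _ = B / n * (w ⬝ᵥ w) := by rw [← Finset.mul_sum, sum_blockPart_dotProduct_self]
    _ ≤ B / n * (B * n * L ^ 2) := by gcongr
    _ = L ^ 2 * B ^ 2 := by field_simp
    _ ≤ L ^ 2 * B ^ 3 := by gcongr; norm_num

variable {μ ν : Measure (κ → ℝ)} [IsProbabilityMeasure μ] [IsProbabilityMeasure ν]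
  {T : Matrix κ κ ℝ} {β C : ℝ} {s : Finset (κ → ℝ)} {b : (κ → ℝ) → ℝ} {h : (κ → ℝ) → ℝ}

theorem ThirdDerivControl.abs_integral_sub_le_of_isBlockIndep
    (hh : ThirdDerivControl h (fun y => gibbsMean β s b fun w => |y ⬝ᵥ w| ^ (2 * m)) L C (2 * m))
    (hμ : IsCenteredLaw μ T (2 * m + 3) fun _ => B / √n)
    (hν : IsCenteredLaw ν T (2 * m + 3) fun _ => B / √n)
    (hμc : IsBlockIndep μ c) (hνc : IsBlockIndep ν c) (hd : ∀ a, blockCard c a ≤ d) (hn : 0 < n)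
    (hB : 1 ≤ B) (hκ : Fintype.card κ ≤ B * n) (hT : ∀ u, u ⬝ᵥ T *ᵥ u ≤ B / n * (u ⬝ᵥ u))
    (hC : 0 ≤ C) (hL : 1 ≤ L) (hs : s.Nonempty) (hw : ∀ w ∈ s, ∀ j, |w j| ≤ L) :
    |∫ z, h z ∂μ - ∫ z, h z ∂ν| ≤ 4 * 8 ^ (m * m) * B ^ (5 * m + 3) * C * L ^ (2 * m + 3) *
      sigmaRate (2 * m) n (Fintype.card κ) d := by
  have hhm := hh.contDiff.continuous.measurable
  have hprob : ∀ (lam : Measure (κ → ℝ)) [IsProbabilityMeasure lam] a,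
      IsProbabilityMeasure (lam.map (blockPart c a)) := fun lam _ a =>
    Measure.isProbabilityMeasure_map (measurable_blockPart c a).aemeasurable
  have hv : ∀ a j, 0 ≤ blockPart c a (fun _ => B / √n) j := fun a j => by
    unfold blockPart
    split_ifs <;> positivity
  have hsum : ∀ a, L * ∑ j, blockPart c a (fun _ => B / √n) j = L * (B / √n) * blockCard c a :=
    fun a => by rw [sum_blockPart_const]; ring
  rw [hμc.integral_eq hhm, hνc.integral_eq hhm]
  refine (hh.abs_integral_sum_sub_le (Λ := 1 + (d : ℝ) ^ (m + 1) / n) (W := L ^ 2 * B ^ 3)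
    (fun a => hμ.map_blockPart c a) (fun a => hν.map_blockPart c a) hv hC (by linarith)
    (le_add_of_nonneg_right (by positivity)) hs hw
    (fun w hws => sum_dotProduct_blockMatrix_mulVec_le hn hB hκ hT (hw w hws))
    fun j h2j hj => ?_).trans ?_
  · simp only [hsum]
    exact sum_blockCard_mul_even_pow_le hd hn hB hκ h2j hj
  · simp only [hsum]
    rw [← Finset.mul_sum]
    refine (mul_le_mul_of_nonneg_left (sum_blockCard_error_le hd hn hB hL)
      (by positivity)).trans_eq ?_
    ring

end CommonPartition

section TwoPartitions

variable {κ : Type*} [Fintype κ] {μ ν : Measure (κ → ℝ)} [IsProbabilityMeasure μ]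
  [IsProbabilityMeasure ν] {T : Matrix κ κ ℝ} {d m n : ℕ} {B L β C : ℝ} {s : Finset (κ → ℝ)}
  {b : (κ → ℝ) → ℝ} {h : (κ → ℝ) → ℝ}

/-- `μ` is a centred law with second moment matrix `T`, coordinates of `L^r`-norm at most `t`, and
independent subvectors on the cells, of size at most `d`, of some partition. -/
structure IsBlockLaw (μ : Measure (κ → ℝ)) (T : Matrix κ κ ℝ) (d r : ℕ) (t : ℝ) : Prop where
  isCenteredLaw : IsCenteredLaw μ T r fun _ => t
  exists_partition : ∃ (k : ℕ) (c : κ → Fin k), (∀ a, blockCard c a ≤ d) ∧ IsBlockIndep μ c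

-- The decoupled law shares the partition of `μ` as well as the partition of `ν`.
theorem ThirdDerivControl.abs_integral_sub_le_sigmaRate
    (hh : ThirdDerivControl h (fun y => gibbsMean β s b fun w => |y ⬝ᵥ w| ^ (2 * m)) L C (2 * m))
    (hμ : IsBlockLaw μ T d (2 * m + 3) (B / √n)) (hν : IsBlockLaw ν T d (2 * m + 3) (B / √n))
    (hn : 0 < n) (hB : 1 ≤ B) (hκ : Fintype.card κ ≤ B * n)
    (hT : ∀ u, u ⬝ᵥ T *ᵥ u ≤ B / n * (u ⬝ᵥ u)) (hC : 0 ≤ C) (hL : 1 ≤ L) (hs : s.Nonempty)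
    (hw : ∀ w ∈ s, ∀ j, |w j| ≤ L) :
    |∫ z, h z ∂μ - ∫ z, h z ∂ν| ≤ 8 * 8 ^ (m * m) * B ^ (5 * m + 3) * C * L ^ (2 * m + 3) *
      sigmaRate (2 * m) n (Fintype.card κ) d := by
  obtain ⟨hμ, k, c, hd, hμc⟩ := hμ
  obtain ⟨hν, k', c', hd', hνc⟩ := hν
  have hη := hμ.decouple (c := c) (c' := c') (fun _ _ => hμ.secondMoment_eq_zero hμc)
    fun _ _ => hν.secondMoment_eq_zero hνc
  have hμη := hh.abs_integral_sub_le_of_isBlockIndep hμ hη hμc isBlockIndep_decouple_left hd hn hB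
    hκ hT hC hL hs hw
  have hην := hh.abs_integral_sub_le_of_isBlockIndep hη hν isBlockIndep_decouple_right hνc hd' hn hB
    hκ hT hC hL hs hw
  refine (abs_sub_le _ _ _).trans ((add_le_add hμη hην).trans_eq ?_)
  ring

end TwoPartitions

theorem abs_iteratedDeriv_le_Kg {g : ℝ → ℝ} (hg : BoundedDerivs g) (k : Fin 4) (x : ℝ) :
    |iteratedDeriv k g x| ≤ Kg g := by
  have hx := le_ciSup (hg k) x
  have hk := le_ciSup (f := fun k : Fin 4 => ⨆ x : ℝ, |iteratedDeriv k g x|)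
    (Set.finite_range _).bddAbove k
  rw [Kg]
  linarith

theorem Kg_nonneg {g : ℝ → ℝ} (hg : BoundedDerivs g) : 0 ≤ Kg g :=
  (abs_nonneg _).trans (abs_iteratedDeriv_le_Kg hg 0 0)

theorem Av_nonneg {n : ℕ} {Lc : Fin n → ℝ} (hL : ∀ i, 0 ≤ Lc i) (a : ℝ) : 0 ≤ Av Lc a :=
  mul_nonneg (by positivity) (Finset.sum_nonneg fun i _ => Real.rpow_nonneg (hL i) a)

theorem mul_qMax_le_qBar (q : Fin 4 → ℝ) : q 0 * qMax q ≤ qBar q := by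
  have := Nat.le_ceil (q 0 * qMax q / 2)
  rw [qBar]
  push_cast
  linarith

theorem qMax_nonneg {q : Fin 4 → ℝ} (hq : ∀ k, 0 ≤ q k) : 0 ≤ qMax q :=
  (hq 3).trans ((le_max_right _ _).trans (le_max_right _ _))

namespace LossAssumption

variable {q : Fin 4 → ℝ} {n : ℕ} {ℓ : Fin n → ℝ → ℝ} {ℓs : Fin n → ℝ → ℝ → ℝ} {ρbar : ℝ}
  {Lc : Fin n → ℝ} {D A : ℝ → ℝ} {ρ : ℝ}

theorem smooth_le (h : LossAssumption q ℓ ℓs ρbar Lc D A) (i : Fin n) (hρ : ρ ∈ Set.Ioo 0 ρbar)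
    (x : ℝ) : max 1 (ℓs i ρ x) ≤ 3 * Lc i * max 1 |x| ^ q 0 := by
  have hL := h.one_le_Lc i
  have hpow : 1 ≤ max 1 |x| ^ q 0 := Real.one_le_rpow (le_max_left _ _) (h.q_nonneg 0)
  have hx : |x| ^ q 0 ≤ max 1 |x| ^ q 0 :=
    Real.rpow_le_rpow (abs_nonneg _) (le_max_right _ _) (h.q_nonneg 0)
  have hgrowth : |ℓ i x| ≤ Lc i * (1 + |x| ^ q 0) :=
    (div_le_iff₀ (by positivity)).1 (h.growth i x)
  have happrox : ℓs i ρ x ≤ 1 + Lc i * (1 + |x| ^ q 0) := by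
    linarith [(abs_le.1 (h.approx i ρ hρ x)).2, h.A_le_one ρ hρ, le_abs_self (ℓ i x)]
  refine max_le ?_ ?_ <;> nlinarith

theorem selfBounded (h : LossAssumption q ℓ ℓs ρbar Lc D A) (i : Fin n)
    (hρ : ρ ∈ Set.Ioo 0 ρbar) :
    SelfBounded q (2 * D ρ) (3 ^ qMax q * Lc i ^ qMax q) (qBar q) (ℓs i ρ) where
  contDiff := h.smooth_contDiff i ρ hρ
  abs_iteratedDeriv_le k hk x := by
    have hℓ := h.smooth_nonneg i ρ hρ x
    have hD := h.one_le_D ρ hρ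
    have hbound := h.self_bounding k hk i ρ hρ x
    rw [abs_of_nonneg hℓ, div_le_iff₀ (by positivity)] at hbound
    have hone : 1 ≤ max 1 (ℓs i ρ x) ^ q k := Real.one_le_rpow (le_max_left _ _) (h.q_nonneg k)
    have hle : ℓs i ρ x ^ q k ≤ max 1 (ℓs i ρ x) ^ q k :=
      Real.rpow_le_rpow hℓ (le_max_right _ _) (h.q_nonneg k)
    calc _ ≤ D ρ * (1 + ℓs i ρ x ^ q k) := hbound
      _ ≤ D ρ * (max 1 (ℓs i ρ x) ^ q k + max 1 (ℓs i ρ x) ^ q k) := by gcongr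
      _ = _ := by ring
  growth x := by
    have hL : 0 ≤ Lc i := zero_le_one.trans (h.one_le_Lc i)
    have hmax : max 1 |x| ^ qBar q ≤ 1 + |x| ^ qBar q := by
      rcases max_choice 1 |x| with hx | hx <;> rw [hx]
      · rw [one_pow]
        exact le_add_of_nonneg_right (by positivity)
      · exact le_add_of_nonneg_left zero_le_one
    calc max 1 (ℓs i ρ x) ^ qMax q ≤ (3 * Lc i * max 1 |x| ^ q 0) ^ qMax q :=
          Real.rpow_le_rpow (by positivity) (h.smooth_le i hρ x) (qMax_nonneg h.q_nonneg)
      _ = 3 ^ qMax q * Lc i ^ qMax q * max 1 |x| ^ (q 0 * qMax q) := by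
          rw [Real.mul_rpow (by positivity) (by positivity), Real.mul_rpow (by norm_num) hL,
            ← Real.rpow_mul (by positivity)]
      _ ≤ 3 ^ qMax q * Lc i ^ qMax q * max 1 |x| ^ (qBar q : ℝ) := by
          gcongr
          exacts [le_max_left _ _, mul_qMax_le_qBar q]
      _ ≤ _ := by
          rw [Real.rpow_natCast]
          gcongr

end LossAssumption

section Rows

variable {n p : ℕ} {β : ℝ} {s : Finset (Fin p → ℝ)}

theorem normalizedSoftMin_update (hn : 0 < n) (ℓ : Fin n → ℝ → ℝ) (R : (Fin p → ℝ) → ℝ)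
    (x : Fin n → Fin p → ℝ) (i : Fin n) (z : Fin p → ℝ) :
    normalizedSoftMin β s ℓ R (Function.update x i z) =
      1 / n * softMin β s fun w =>
        ∑ j ∈ Finset.univ.erase i, ℓ j (x j ⬝ᵥ w) + n * R w + ℓ i (z ⬝ᵥ w) := by
  have hn' : (n : ℝ) ≠ 0 := Nat.cast_ne_zero.2 hn.ne'
  rw [normalizedSoftMin]
  congr 2
  funext w
  have hrest : ∑ j ∈ Finset.univ.erase i, ℓ j (Function.update x i z j ⬝ᵥ w) =
      ∑ j ∈ Finset.univ.erase i, ℓ j (x j ⬝ᵥ w) :=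
    Finset.sum_congr rfl fun j hj => by rw [Function.update_of_ne (Finset.ne_of_mem_erase hj)]
  rw [risk, ← Finset.sum_erase_add _ _ (Finset.mem_univ i), hrest, Function.update_self]
  field_simp
  ring

theorem measurable_normalizedSoftMin {ℓ : Fin n → ℝ → ℝ} (hℓ : ∀ i, Measurable (ℓ i))
    (R : (Fin p → ℝ) → ℝ) : Measurable (normalizedSoftMin β s ℓ R) := by
  unfold normalizedSoftMin softMin risk dotProduct
  fun_prop

theorem normalizedSoftMin_empty (ℓ : Fin n → ℝ → ℝ) (R : (Fin p → ℝ) → ℝ)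
    (x : Fin n → Fin p → ℝ) : normalizedSoftMin β ∅ ℓ R x = 0 := by
  simp [normalizedSoftMin, softMin]

variable {q : Fin 4 → ℝ} {ℓ : Fin n → ℝ → ℝ} {ℓs : Fin n → ℝ → ℝ → ℝ} {ρbar : ℝ}
  {Lc : Fin n → ℝ} {D A : ℝ → ℝ} {ρ L : ℝ} {g : ℝ → ℝ}

theorem LossAssumption.measurable_comp_normalizedSoftMin
    (h : LossAssumption q ℓ ℓs ρbar Lc D A) (R : (Fin p → ℝ) → ℝ) (hρ : ρ ∈ Set.Ioo 0 ρbar)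
    (hg : Measurable g) :
    Measurable fun x => g (normalizedSoftMin β s (fun i => ℓs i ρ) R x) :=
  hg.comp (measurable_normalizedSoftMin
    (fun i => (h.smooth_contDiff i ρ hρ).continuous.measurable) R)

theorem LossAssumption.thirdDerivControl_update (h : LossAssumption q ℓ ℓs ρbar Lc D A)
    (hn : 0 < n) (hL : 0 ≤ L) (hs : s.Nonempty) (hw : ∀ w ∈ s, ∀ j, |w j| ≤ L)
    (R : (Fin p → ℝ) → ℝ) (hρ : ρ ∈ Set.Ioo 0 ρbar) (hβ : 0 < β) (hg : ContDiff ℝ 3 g)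
    (hgb : BoundedDerivs g) (x : Fin n → Fin p → ℝ) (i : Fin n) :
    ThirdDerivControl
      (fun z => g (normalizedSoftMin β s (fun i => ℓs i ρ) R (Function.update x i z)))
      (fun y => gibbsMean β s
        (fun w => ∑ j ∈ Finset.univ.erase i, ℓs j ρ (x j ⬝ᵥ w) + n * R w)
        fun w => |y ⬝ᵥ w| ^ qBar q) L
      (23 * Kg g * max 1 (β ^ 2) * (2 * D ρ) ^ 3 *
        (3 ^ qMax q * Lc i ^ qMax q * 2 ^ qBar q) / n) (qBar q) := by
  simp only [normalizedSoftMin_update hn]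
  exact (h.selfBounded i hρ).thirdDerivControl hs hβ h.q_nonneg
    (by linarith [h.one_le_D ρ hρ]) hL hw hg (abs_iteratedDeriv_le_Kg hgb) (Nat.one_le_cast.2 hn)

theorem LossAssumption.abs_integral_pi_sub_le {d m : ℕ} {B : ℝ}
    {μ ν : Fin n → Measure (Fin p → ℝ)} [∀ i, IsProbabilityMeasure (μ i)]
    [∀ i, IsProbabilityMeasure (ν i)] {T : Fin n → Matrix (Fin p) (Fin p) ℝ}
    (h : LossAssumption q ℓ ℓs ρbar Lc D A) (hm : qBar q = 2 * m)
    (hμ : ∀ i, IsBlockLaw (μ i) (T i) d (2 * m + 3) (B / √n))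
    (hν : ∀ i, IsBlockLaw (ν i) (T i) d (2 * m + 3) (B / √n))
    (hn : 0 < n) (hB : 1 ≤ B) (hp : p ≤ B * n)
    (hT : ∀ i u, u ⬝ᵥ T i *ᵥ u ≤ B / n * (u ⬝ᵥ u)) (hL : 1 ≤ L) (hs : s.Nonempty)
    (hw : ∀ w ∈ s, ∀ j, |w j| ≤ L) (R : (Fin p → ℝ) → ℝ) (hρ : ρ ∈ Set.Ioo 0 ρbar) (hβ : 0 < β)
    (hg : ContDiff ℝ 3 g) (hgb : BoundedDerivs g) :
    |∫ x, g (normalizedSoftMin β s (fun i => ℓs i ρ) R x) ∂Measure.pi μ -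
        ∫ x, g (normalizedSoftMin β s (fun i => ℓs i ρ) R x) ∂Measure.pi ν| ≤
      1472 * 8 ^ (m * m) * B ^ (5 * m + 3) * 3 ^ qMax q * 2 ^ (2 * m) * Kg g * max 1 (β ^ 2) *
        L ^ (2 * m + 3) * D ρ ^ 3 * Av Lc (qMax q) * sigmaRate (2 * m) n p d := by
  have hD := h.one_le_D ρ hρ
  have hK := Kg_nonneg hgb
  set C : Fin n → ℝ := fun i => 23 * Kg g * max 1 (β ^ 2) * (2 * D ρ) ^ 3 *
    (3 ^ qMax q * Lc i ^ qMax q * 2 ^ (2 * m)) / n with hC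
  set ε : Fin n → ℝ := fun i => 8 * 8 ^ (m * m) * B ^ (5 * m + 3) * C i * L ^ (2 * m + 3) *
    sigmaRate (2 * m) n p d with hε
  refine (abs_integral_pi_sub_le_sum μ ν
    (h.measurable_comp_normalizedSoftMin R hρ hg.continuous.measurable)
    (fun x => by
      simpa only [Fin.val_zero, iteratedDeriv_zero] using abs_iteratedDeriv_le_Kg hgb 0 _)
    (R := fun i _ => ε i) (ε := ε) (fun i x => ?_) fun lam hlam i => ?_).trans_eq ?_
  · have hcontrol := h.thirdDerivControl_update hn (zero_le_one.trans hL) hs hw R hρ hβ hg hgb x i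
    rw [hm] at hcontrol
    have hLc : 0 ≤ Lc i := zero_le_one.trans (h.one_le_Lc i)
    simpa only [Fintype.card_fin] using hcontrol.abs_integral_sub_le_sigmaRate (hμ i) (hν i) hn hB
      (by rwa [Fintype.card_fin]) (hT i) (by positivity) hL hs hw
  · have : ∀ j, IsProbabilityMeasure (lam j) := fun j => by
      obtain h_eq | h_eq := hlam j <;> rw [h_eq] <;> infer_instance
    exact ⟨integrable_const _, by simp⟩
  · simp only [hε, hC, Av, ← Finset.sum_mul, ← Finset.mul_sum, ← Finset.sum_div]
    ring

end Rows

section Designs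

variable {Ω : Type*} [MeasurableSpace Ω] {P : Measure Ω} {n p d : ℕ}

theorem qBar_add_three_le_qStar (q : Fin 4 → ℝ) : (qBar q + 3 : ℕ) ≤ qStar q := by
  have hpow : ∀ m : ℕ, 2 * m + 3 ≤ 2 ^ (m + 2) := fun m => by
    induction m with
    | zero => norm_num
    | succ m ih => rw [pow_succ]; omega
  have hq : qStar q = ((2 ^ (⌈q 0 * qMax q / 2⌉₊ + 2) : ℕ) : ℝ) := by
    rw [qStar, qBar]
    push_cast
    rw [← Real.rpow_natCast]
    congr 1
    push_cast
    ring
  rw [hq]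
  exact Nat.cast_le.2 (hpow _)

open scoped MatrixOrder in
theorem dotProduct_mulVec_le_of_eigenvalues_le {κ : Type*} [Fintype κ] [DecidableEq κ]
    {S : Matrix κ κ ℝ} (hS : S.IsHermitian) {M : ℝ} (hM : ∀ j, hS.eigenvalues j ≤ M) (u : κ → ℝ) :
    u ⬝ᵥ S *ᵥ u ≤ M * (u ⬝ᵥ u) := by
  have hle : S ≤ algebraMap ℝ (Matrix κ κ ℝ) M := by
    refine le_algebraMap_of_spectrum_le (fun x hx => ?_) hS.isSelfAdjoint
    rw [hS.spectrum_real_eq_range_eigenvalues] at hx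
    obtain ⟨j, rfl⟩ := hx
    exact hM j
  have hnonneg := (Matrix.le_iff.1 hle).dotProduct_mulVec_nonneg u
  rw [Algebra.algebraMap_eq_smul_one] at hnonneg
  simp only [star_trivial, Matrix.sub_mulVec, Matrix.smul_mulVec, Matrix.one_mulVec,
    dotProduct_sub, dotProduct_smul, smul_eq_mul] at hnonneg
  linarith

theorem IsBlockDependent.exists_partition [IsProbabilityMeasure P] {Z : Ω → Fin p → ℝ}
    (hZ : Measurable Z) (h : IsBlockDependent P d Z) : ∃ (k : ℕ) (c : Fin p → Fin k),
      (∀ a, blockCard c a ≤ d) ∧ IsBlockIndep (P.map Z) c := by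
  obtain ⟨k, B, -, hdisj, hcover, hcard, hindep⟩ := h
  choose c hc using hcover
  have hiff : ∀ l a, c l = a ↔ l ∈ B a := fun l a => by
    refine ⟨fun h => h ▸ hc l, fun h => ?_⟩
    by_contra hne
    exact Finset.disjoint_left.1 (hdisj _ _ hne) (hc l) h
  refine ⟨k, c, fun a => ?_, ?_⟩
  · have hcell : Finset.univ.filter (fun l => c l = a) = B a := by
      ext l
      simp [hiff]
    rw [blockCard, hcell]
    exact hcard a
  · rw [IsBlockIndep, iIndepFun_map_iff hZ (measurable_blockPart c)]
    have hextend := hindep.comp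
      (fun a (y : B a → ℝ) (l : Fin p) => if h : l ∈ B a then y ⟨l, h⟩ else 0)
      fun a => measurable_pi_lambda _ fun l => by
        split_ifs
        exacts [measurable_pi_apply _, measurable_const]
    convert hextend using 3 with a ω
    funext l
    simp [blockPart, hiff]

/-- The rows `Z 0, …, Z (n - 1)` are independent centred `d`-block dependent random vectors in
`ℝ^p`, the `i`-th one with covariance matrix `S i / n`, and the coordinates of the rescaled rows
`√n Z i` have `L^r`-norm at most `M`. Unlike in `IsDesign`, the rows may have different laws. -/
structure IsBlockArray (P : Measure Ω) (d : ℕ) (S : Fin n → Matrix (Fin p) (Fin p) ℝ) (r : ℕ)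
    (M : ℝ) (Z : Fin n → Ω → Fin p → ℝ) : Prop where
  measurable : ∀ i, Measurable (Z i)
  indep : iIndepFun Z P
  blockDependent : ∀ i, IsBlockDependent P d (Z i)
  mean : ∀ i j, ∫ ω, Z i ω j ∂P = 0
  secondMoment : ∀ i j k, ∫ ω, Z i ω j * Z i ω k ∂P = S i j k / n
  moment : ∀ i j, eLpNorm (fun ω => √n * Z i ω j) r P ≤ ENNReal.ofReal M

variable {M : ℝ} {Z : Fin n → Ω → Fin p → ℝ}

theorem IsDesign.isBlockArray [IsProbabilityMeasure P] {S : Matrix (Fin p) (Fin p) ℝ} {r : ℝ}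
    {k : ℕ} (h : IsDesign P d S r M Z) (hk : k ≤ r) : IsBlockArray P d (fun _ => S) k M Z where
  measurable := h.measurable
  indep := h.indep
  blockDependent := h.blockDependent
  mean := h.mean
  secondMoment := h.secondMoment
  moment i j := by
    have hZ := h.measurable i
    refine (eLpNorm_le_eLpNorm_of_exponent_le ?_ (by fun_prop)).trans (h.moment i j)
    rw [← ENNReal.ofReal_natCast]
    exact ENNReal.ofReal_le_ofReal hk

namespace IsBlockArray

variable {S : Fin n → Matrix (Fin p) (Fin p) ℝ} {r : ℕ}

theorem mono (h : IsBlockArray P d S r M Z) {M' : ℝ} (hM : M ≤ M') : IsBlockArray P d S r M' Z :=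
  { h with moment := fun i j => (h.moment i j).trans (ENNReal.ofReal_le_ofReal hM) }

theorem isBlockLaw [IsProbabilityMeasure P] (h : IsBlockArray P d S r M Z) (hn : 0 < n)
    (i : Fin n) :
    IsBlockLaw (P.map (Z i)) ((n : ℝ)⁻¹ • S i) d r (M / √n) where
  isCenteredLaw := by
    have hZ := h.measurable i
    refine ⟨fun j => ?_, fun j k => ?_, fun j => ?_⟩
    · rw [integral_map hZ.aemeasurable (measurable_pi_apply j).aestronglyMeasurable]
      exact h.mean i j
    · rw [integral_map hZ.aemeasurable (by fun_prop), h.secondMoment, Matrix.smul_apply,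
        smul_eq_mul, inv_mul_eq_div]
    · have hr : 0 < √(n : ℝ) := Real.sqrt_pos.2 (Nat.cast_pos.2 hn)
      rw [eLpNorm_map_measure (measurable_pi_apply j).aestronglyMeasurable hZ.aemeasurable]
      calc eLpNorm (fun ω => Z i ω j) r P
          = eLpNorm ((√n)⁻¹ • fun ω => √n * Z i ω j) r P := by
            congr 1
            funext ω
            exact (inv_mul_cancel_left₀ hr.ne' _).symm
        _ = ENNReal.ofReal (√n)⁻¹ * eLpNorm (fun ω => √n * Z i ω j) r P := by
            rw [eLpNorm_const_smul, Real.enorm_of_nonneg (by positivity)]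
        _ ≤ ENNReal.ofReal (√n)⁻¹ * ENNReal.ofReal M := by
            gcongr
            exact h.moment i j
        _ = ENNReal.ofReal (M / √n) := by
            rw [← ENNReal.ofReal_mul (by positivity), inv_mul_eq_div]
  exists_partition := (h.blockDependent i).exists_partition (h.measurable i)

theorem integral_eq (h : IsBlockArray P d S r M Z) {f : (Fin n → Fin p → ℝ) → ℝ}
    (hf : Measurable f) :
    ∫ ω, f (fun i => Z i ω) ∂P = ∫ x, f x ∂Measure.pi fun i => P.map (Z i) := by
  rw [← h.indep.map_fun_eq_pi_map fun i => (h.measurable i).aemeasurable,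
    integral_map (measurable_pi_lambda _ h.measurable).aemeasurable hf.aestronglyMeasurable]

end IsBlockArray

variable {Ω' : Type*} [MeasurableSpace Ω'] {P' : Measure Ω'} [IsProbabilityMeasure P]
  [IsProbabilityMeasure P'] {S : Fin n → Matrix (Fin p) (Fin p) ℝ} {X : Fin n → Ω → Fin p → ℝ}
  {W : Fin n → Ω' → Fin p → ℝ} {q : Fin 4 → ℝ} {ℓ : Fin n → ℝ → ℝ} {ℓs : Fin n → ℝ → ℝ → ℝ}
  {ρbar : ℝ} {Lc : Fin n → ℝ} {D A : ℝ → ℝ} {ρ β B L : ℝ} {g : ℝ → ℝ} {s : Finset (Fin p → ℝ)}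

theorem LossAssumption.abs_integral_sub_le {m : ℕ} (h : LossAssumption q ℓ ℓs ρbar Lc D A)
    (hm : qBar q = 2 * m) (hX : IsBlockArray P d S (2 * m + 3) B X)
    (hW : IsBlockArray P' d S (2 * m + 3) B W) (hn : 0 < n) (hB : 1 ≤ B) (hp : p ≤ B * n)
    (hS : ∀ i u, u ⬝ᵥ S i *ᵥ u ≤ B * (u ⬝ᵥ u)) (hL : 1 ≤ L) (hs : ∀ w ∈ s, ∀ j, |w j| ≤ L)
    (R : (Fin p → ℝ) → ℝ) (hρ : ρ ∈ Set.Ioo 0 ρbar) (hβ : 0 < β) (hg : ContDiff ℝ 3 g)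
    (hgb : BoundedDerivs g) :
    |∫ ω, g (normalizedSoftMin β s (fun i => ℓs i ρ) R fun i => X i ω) ∂P -
        ∫ ω, g (normalizedSoftMin β s (fun i => ℓs i ρ) R fun i => W i ω) ∂P'| ≤
      1472 * 8 ^ (m * m) * B ^ (5 * m + 3) * 3 ^ qMax q * 2 ^ (2 * m) * Kg g * max 1 (β ^ 2) *
        L ^ (2 * m + 3) * D ρ ^ 3 * Av Lc (qMax q) * sigmaRate (2 * m) n p d := by
  obtain rfl | hne := s.eq_empty_or_nonempty
  · have hD := h.one_le_D ρ hρ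
    have hK := Kg_nonneg hgb
    have hAv := Av_nonneg (fun i => zero_le_one.trans (h.one_le_Lc i)) (qMax q)
    have hσ := sigmaRate_nonneg (2 * m) n p d
    simp only [normalizedSoftMin_empty, integral_const, probReal_univ, sub_self, abs_zero]
    positivity
  have hF := h.measurable_comp_normalizedSoftMin (β := β) (s := s) R hρ hg.continuous.measurable
  have hPX := fun i => Measure.isProbabilityMeasure_map (μ := P) (hX.measurable i).aemeasurable
  have hPW := fun i => Measure.isProbabilityMeasure_map (μ := P') (hW.measurable i).aemeasurable
  have hT : ∀ i u, u ⬝ᵥ ((n : ℝ)⁻¹ • S i) *ᵥ u ≤ B / n * (u ⬝ᵥ u) := fun i u => by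
    rw [Matrix.smul_mulVec, dotProduct_smul, smul_eq_mul, inv_mul_eq_div, div_mul_eq_mul_div]
    gcongr
    exact hS i u
  rw [hX.integral_eq hF, hW.integral_eq hF]
  exact h.abs_integral_pi_sub_le hm (fun i => hX.isBlockLaw hn i) (fun i => hW.isBlockLaw hn i) hn
    hB hp hT hL hne hs R hρ hβ hg hgb

end Designs

end BlockUniversality

end

theorem proposition1_general (γ : ℝ) (q : Fin 4 → ℝ) (M : ℝ) :
    ∃ C₀ : ℝ, 0 < C₀ ∧
      ∀ (n p d : ℕ), 0 < n → (p : ℝ) / n ≤ γ →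
      ∀ (ℓ : Fin n → ℝ → ℝ) (ℓs : Fin n → ℝ → ℝ → ℝ) (ρbar : ℝ) (Lc : Fin n → ℝ) (D A : ℝ → ℝ),
        BlockUniversality.LossAssumption q ℓ ℓs ρbar Lc D A →
      ∀ (R : (Fin p → ℝ) → ℝ) (S : Fin n → Matrix (Fin p) (Fin p) ℝ),
        (∀ i u, u ⬝ᵥ S i *ᵥ u ≤ M * (u ⬝ᵥ u)) →
      ∀ (Ω : Type*) [MeasurableSpace Ω] (P : Measure Ω) [IsProbabilityMeasure P]
        (X : Fin n → Ω → Fin p → ℝ),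
        BlockUniversality.IsBlockArray P d S (BlockUniversality.qBar q + 3) M X →
      ∀ (Ω' : Type*) [MeasurableSpace Ω'] (P' : Measure Ω') [IsProbabilityMeasure P']
        (W : Fin n → Ω' → Fin p → ℝ),
        BlockUniversality.IsBlockArray P' d S (BlockUniversality.qBar q + 3) M W →
      ∀ (L : ℝ), 1 ≤ L →
      ∀ (s : Finset (Fin p → ℝ)), (∀ w ∈ s, ∀ j, w j ∈ Set.Icc (-L) L) →
      ∀ ρ ∈ Set.Ioo 0 ρbar, ∀ (β : ℝ), 0 < β →
      ∀ (g : ℝ → ℝ), ContDiff ℝ 3 g → BlockUniversality.BoundedDerivs g →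
        |(∫ ω, g (BlockUniversality.normalizedSoftMin β s (fun i => ℓs i ρ) R
              (fun i => X i ω)) ∂P)
          - ∫ ω, g (BlockUniversality.normalizedSoftMin β s (fun i => ℓs i ρ) R
              (fun i => W i ω)) ∂P'|
        ≤ C₀ * BlockUniversality.Kg g * max 1 (β ^ 2) * L ^ (BlockUniversality.qBar q + 3)
            * (D ρ) ^ 3 * BlockUniversality.Av Lc (BlockUniversality.qMax q)
            * BlockUniversality.sigmaRate (BlockUniversality.qBar q) n p d := by
  open BlockUniversality in
  obtain ⟨m, hm⟩ : ∃ m, qBar q = 2 * m := ⟨_, rfl⟩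
  set B := max (max M γ) 1
  have hB : 1 ≤ B := le_max_right _ _
  have hMB : M ≤ B := (le_max_left M γ).trans (le_max_left _ _)
  have hγB : γ ≤ B := (le_max_right M γ).trans (le_max_left _ _)
  rw [hm]
  refine ⟨1472 * 8 ^ (m * m) * B ^ (5 * m + 3) * 3 ^ qMax q * 2 ^ (2 * m), by positivity, ?_⟩
  intro n p d hn hpn ℓ ℓs ρbar Lc D A hℓ R S hS Ω _ P _ X hX Ω' _ P' _ W hW L hL s hs ρ hρ β hβ g
    hg hgb
  have hp : p ≤ B * n := (div_le_iff₀ (Nat.cast_pos.2 hn)).1 (hpn.trans hγB)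
  have hSB : ∀ i u, u ⬝ᵥ S i *ᵥ u ≤ B * (u ⬝ᵥ u) := fun i u =>
    (hS i u).trans (mul_le_mul_of_nonneg_right hMB (Finset.sum_nonneg fun j _ => mul_self_nonneg _))
  exact hℓ.abs_integral_sub_le hm (hX.mono hMB) (hW.mono hMB) hn hB hp hSB hL
    (fun w hw j => abs_le.2 (hs w hw j)) R hρ hβ hg hgb

theorem proposition1 (τ : ℝ) (hτ : τ ∈ Set.Ioo (0 : ℝ) 1) (q : Fin 4 → ℝ) (M : ℝ) :
    ∃ C₀ : ℝ, 0 < C₀ ∧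
      ∀ (n p d : ℕ), BlockUniversality.ProportionalRegime τ n p →
      ∀ (ℓ : Fin n → ℝ → ℝ) (ℓs : Fin n → ℝ → ℝ → ℝ) (ρbar : ℝ) (Lc : Fin n → ℝ) (D A : ℝ → ℝ),
        BlockUniversality.LossAssumption q ℓ ℓs ρbar Lc D A →
      ∀ (R : (Fin p → ℝ) → ℝ)
        (S : Matrix (Fin p) (Fin p) ℝ) (hS : S.PosDef),
        (∀ j, hS.isHermitian.eigenvalues j ≤ M) →
      ∀ (Ω : Type*) [MeasurableSpace Ω] (P : Measure Ω) [IsProbabilityMeasure P]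
        (X : Fin n → Ω → Fin p → ℝ),
        BlockUniversality.IsDesign P d S (BlockUniversality.qStar q) M X →
      ∀ (Ω' : Type*) [MeasurableSpace Ω'] (P' : Measure Ω') [IsProbabilityMeasure P']
        (W : Fin n → Ω' → Fin p → ℝ),
        BlockUniversality.IsDesign P' d S (BlockUniversality.qStar q) M W →
      ∀ (L : ℝ), 1 ≤ L →
      ∀ (s : Finset (Fin p → ℝ)), (∀ w ∈ s, ∀ j, w j ∈ Set.Icc (-L) L) →
      ∀ ρ ∈ Set.Ioo 0 ρbar, ∀ (β : ℝ), 0 < β →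
      ∀ (g : ℝ → ℝ), ContDiff ℝ 3 g → BlockUniversality.BoundedDerivs g →
        |(∫ ω, g (BlockUniversality.normalizedSoftMin β s (fun i => ℓs i ρ) R
              (fun i => X i ω)) ∂P)
          - ∫ ω, g (BlockUniversality.normalizedSoftMin β s (fun i => ℓs i ρ) R
              (fun i => W i ω)) ∂P'|
        ≤ C₀ * BlockUniversality.Kg g * max 1 (β ^ 2) * L ^ (BlockUniversality.qBar q + 3)
            * (D ρ) ^ 3 * BlockUniversality.Av Lc (BlockUniversality.qMax q)
            * BlockUniversality.sigmaRate (BlockUniversality.qBar q) n p d := by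
  open BlockUniversality in
  obtain ⟨C₀, hC₀, h⟩ := proposition1_general (1 / τ) q M
  refine ⟨C₀, hC₀, ?_⟩
  intro n p d ⟨hn, _, hpn⟩ ℓ ℓs ρbar Lc D A hℓ R S hS hSM Ω _ P _ X hX Ω' _ P' _ W hW
  exact h n p d hn hpn ℓ ℓs ρbar Lc D A hℓ R (fun _ => S)
    (fun _ => dotProduct_mulVec_le_of_eigenvalues_le hS.isHermitian hSM)
    Ω P X (hX.isBlockArray (qBar_add_three_le_qStar q))
    Ω' P' W (hW.isBlockArray (qBar_add_three_le_qStar q))
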